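/- Let $n\ge 1$ and $H^n=L^2(S^1,\mathbb C^n)$, with the orthonormal basis $e_i=z^{\lfloor i/n\rfloor}e_{(i \bmod n)}$, $i\in\mathbb Z$, where $e_0,\dots,e_{n-1}$ is the standard basis of $\mathbb C^n$. Let $H^n_+$ and $H^n_-$ be the closed spans of the $e_i$ with $i\ge 0$ and with $i<0$, with orthogonal projections $\mathrm{pr}_\pm$. Let $Gr^n$ be the set of closed subspaces $W\subset H^n$ such that $\mathrm{pr}_-|_W$ is compact and $\mathrm{pr}_+|_W:W\to H^n_+$ is Fredholm of index zero. A point of the frame bundle is a pair $(W,w)$ with $W\in Gr^n$ and $w:H^n_+\to W$ a bounded isomorphism such that $\mathrm{pr}_+w-1$ is of trace class. The determinant of an infinite matrix is the limit of the determinants of its top left $N\times N$ blocks as $N\to\infty$. Let $\mathbb S$ be the set of sequences $S=(s_0,s_1,\dots)$ of integers with $s_{j+1}>s_j$ for all $j$ and $s_j=j$ for all large $j$, and write $0=(0,1,2,\dots)\in\mathbb S$. The Plücker coordinate $\langle S|w\rangle$ of a frame is the determinant of the infinite matrix $\big(\langle e_{s_l},\,w e_m\rangle\big)_{l,m\ge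 0}$. Let $g(z)=\sum_{k\ge 0}H_kz^k$ be an $n\times n$ matrix-valued function, given by a power series that converges on a neighbourhood of the closed unit disc, with $g(z)$ invertible for all $|z|\le 1$. It acts on $H^n$ by multiplication; let $a=\mathrm{pr}_+\,g|_{H^n_+}$. For $S\in\mathbb S$ let $M_S$ be the infinite matrix whose entry in position $(l,m)$, $l,m\ge 0$, is the $(l\bmod n,\;s_m\bmod n)$ entry of $H_k$ with $k=\lfloor l/n\rfloor-\lfloor s_m/n\rfloor$ (indices of $H_k$ counted from $0$, and $H_k=0$ for $k<0$), and let $f_S^n=\det(M_SM_0^{-1})$ be the $n$-Schur function. Then, for every $W\in Gr^n$ and every point $(W,w)$ of the frame bundle: the operator $a$ is invertible, $(gW,\,gwa^{-1})$ is again a point of the frame bundle, the determinants $\langle S|w\rangle$ and $f_S^n$ $(S\in\mathbb S)$ and $\langle 0|gwa^{-1}\rangle$ exist, and $$\langle 0|\,g w a^{-1}\rangle=\sum_{S\in\mathbb S}\langle S|w\rangle\, f_S^n ,$$ where the sum converges unconditionally. (This is the identity $\langle 0|g|W\rangle=\sum_{S}\langle S|W\rangle f^n_S$, both sides of which are defined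 up to the common multiple that the choice of the admissible basis $w$ of $W$ brings in.) -/

import Mathlib

open MeasureTheory Filter Topology

noncomputable section

namespace NSchur

/-! ### The Hilbert space of vector-valued functions on the circle -/

/-- The unit circle, parametrised by `t ↦ exp (2 π i t)`, `t ∈ ℝ / ℤ`. -/
abbrev Torus : Type := AddCircle (1 : ℝ)

/-- The coordinate `z = exp (2 π i t)` on the circle. -/
def zc (t : Torus) : ℂ := (AddCircle.toCircle t : ℂ)

/-- `H^n = L²(S¹, ℂⁿ)`, for the rotation invariant probability measure. -/
abbrev HS (n : ℕ) : Type :=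
  Lp (EuclideanSpace ℂ (Fin n)) 2 (AddCircle.haarAddCircle : Measure Torus)

/-- The residue of an integer modulo `n`, as an element of `{0, …, n - 1}`. -/
def res (n : ℕ) [NeZero n] (i : ℤ) : Fin n :=
  ⟨(i % (n : ℤ)).toNat, by
    have h : (0 : ℤ) < n := by exact_mod_cast Nat.pos_of_ne_zero (NeZero.ne n)
    have h1 := Int.emod_nonneg i h.ne'
    have h2 := Int.emod_lt_of_pos i h
    omega⟩

/-- The basis function `z ^ ⌊i / n⌋ • e_{i mod n}` (division of integers by `n > 0` is floor
division) as a continuous function; `fourier k` is the monomial `z ^ k`. -/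
def basisFun (n : ℕ) [NeZero n] (i : ℤ) : C(Torus, EuclideanSpace ℂ (Fin n)) where
  toFun t := fourier (i / (n : ℤ)) t • EuclideanSpace.single (res n i) (1 : ℂ)
  continuous_toFun := ((fourier (T := 1) (i / (n : ℤ))).continuous).smul continuous_const

/-- The basis vectors `e_i`, `i ∈ ℤ`, of `H^n`. -/
def e (n : ℕ) [NeZero n] (i : ℤ) : HS n :=
  ContinuousMap.toLp 2 AddCircle.haarAddCircle ℂ (basisFun n i)

/-- `H^n_+`, the closed span of the `e_i` with `i ≥ 0`. -/
def HPlus (n : ℕ) [NeZero n] : Submodule ℂ (HS n) :=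
  (Submodule.span ℂ (e n '' {i | 0 ≤ i})).topologicalClosure

/-- `H^n_-`, the closed span of the `e_i` with `i < 0`. -/
def HMinus (n : ℕ) [NeZero n] : Submodule ℂ (HS n) :=
  (Submodule.span ℂ (e n '' {i | i < 0})).topologicalClosure

instance (n : ℕ) [NeZero n] : CompleteSpace (HPlus n) :=
  (Submodule.isClosed_topologicalClosure _).completeSpace_coe

instance (n : ℕ) [NeZero n] : CompleteSpace (HMinus n) :=
  (Submodule.isClosed_topologicalClosure _).completeSpace_coe

/-- The basis vector `e_i`, `i ≥ 0`, as an element of `H^n_+`. -/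
def ePlus (n : ℕ) [NeZero n] (i : ℕ) : HPlus n :=
  ⟨e n i, Submodule.le_topologicalClosure _
    (Submodule.subset_span ⟨(i : ℤ), Int.natCast_nonneg i, rfl⟩)⟩

/-- The orthogonal projection onto `H^n_+`. -/
def prPlus (n : ℕ) [NeZero n] : HS n →L[ℂ] HPlus n := (HPlus n).orthogonalProjectionOnto

/-- The orthogonal projection onto `H^n_-`. -/
def prMinus (n : ℕ) [NeZero n] : HS n →L[ℂ] HMinus n := (HMinus n).orthogonalProjectionOnto

/-! ### The grassmannian and its frame bundle -/

/-- `W` is a point of `Gr^n`: a closed subspace of `H^n` whose orthogonal projection to `H^n_-` is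
compact and whose orthogonal projection to `H^n_+` is Fredholm of index zero. -/
structure InGr (n : ℕ) [NeZero n] (W : Submodule ℂ (HS n)) : Prop where
  isClosed : IsClosed (W : Set (HS n))
  compact_minus : IsCompactOperator (prMinus n ∘L W.subtypeL)
  fredholm_plus : (prPlus n ∘L W.subtypeL).IsFredholm
  index_plus : (prPlus n ∘L W.subtypeL : W →L[ℂ] HPlus n).toLinearMap.index = 0

/-- Trace class operators between Hilbert spaces: `T = ∑ k, ⟪x k, ·⟫ y k` for vectors with
`∑ k, ‖x k‖ * ‖y k‖ < ∞`. -/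
def IsTraceClass {E F : Type*} [NormedAddCommGroup E] [InnerProductSpace ℂ E]
    [NormedAddCommGroup F] [InnerProductSpace ℂ F] (T : E →L[ℂ] F) : Prop :=
  ∃ (x : ℕ → E) (y : ℕ → F), Summable (fun k => ‖x k‖ * ‖y k‖) ∧
    ∀ v, HasSum (fun k => (inner ℂ (x k) v : ℂ) • y k) (T v)

/-- `(W, w)` is a point of the frame bundle: `W ∈ Gr^n` and `w : H^n_+ → W` is an isomorphism,
viewed as a map to `H^n` (so `w (e_i) = w_i` is the basis of `W`), whose `H^n_+`-component differs
from the identity by an operator of trace class. -/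
structure IsFrame (n : ℕ) [NeZero n] (W : Submodule ℂ (HS n)) (w : HPlus n →L[ℂ] HS n) :
    Prop where
  inGr : InGr n W
  injective : Function.Injective w
  range_eq : w.toLinearMap.range = W
  admissible : IsTraceClass (prPlus n ∘L w - ContinuousLinearMap.id ℂ (HPlus n))

/-! ### Determinants of infinite matrices -/

/-- The top left `N × N` block of an infinite matrix. -/
def topLeft (A : Matrix ℕ ℕ ℂ) (N : ℕ) : Matrix (Fin N) (Fin N) ℂ :=
  A.submatrix (fun i => (i : ℕ)) (fun i => (i : ℕ))

/-- The determinant of the infinite matrix `A` exists and equals `d`. -/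
def HasInfDet (A : Matrix ℕ ℕ ℂ) (d : ℂ) : Prop :=
  Tendsto (fun N => (topLeft A N).det) atTop (𝓝 d)

/-- The determinant of an infinite matrix (meaningful if `HasInfDet A d` for some `d`). -/
def infDet (A : Matrix ℕ ℕ ℂ) : ℂ := limUnder atTop (fun N => (topLeft A N).det)

theorem HasInfDet.infDet_eq {A : Matrix ℕ ℕ ℂ} {d : ℂ} (h : HasInfDet A d) : infDet A = d :=
  h.limUnder_eq

/-! ### The index set and the Plücker coordinates -/

/-- Strictly increasing integer sequences that are eventually equal to their indices. -/
def SSet : Type := {s : ℕ → ℤ // StrictMono s ∧ ∃ N : ℕ, ∀ j : ℕ, N < j → s j = (j : ℤ)}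

/-- The sequence `(0, 1, 2, …)`. -/
def SSet.base : SSet := ⟨fun j => (j : ℤ), fun _ _ h => Int.ofNat_lt.mpr h, 0, fun _ _ => rfl⟩

/-- The matrix of the rows of `w` with indices `s_0, s_1, …`. -/
def rowMatrix (n : ℕ) [NeZero n] (S : SSet) (w : HPlus n →L[ℂ] HS n) : Matrix ℕ ℕ ℂ :=
  Matrix.of fun l m => (inner ℂ (e n (S.1 l)) (w (ePlus n m)) : ℂ)

/-- The Plücker coordinate `⟨S|w⟩` of the frame `w`. -/
def plucker (n : ℕ) [NeZero n] (S : SSet) (w : HPlus n →L[ℂ] HS n) : ℂ :=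
  infDet (rowMatrix n S w)

/-! ### The `n`-Schur functions -/

/-- The block Toeplitz matrix with blocks `H_k`: the entry in row `l` and column `s` is the
`(l mod n, s mod n)` entry of `H_k`, `k = ⌊l / n⌋ - ⌊s / n⌋`, where `H_k = 0` for `k < 0`. -/
def blockToeplitz (n : ℕ) [NeZero n] (H : ℕ → Matrix (Fin n) (Fin n) ℂ) (l s : ℤ) : ℂ :=
  if s / (n : ℤ) ≤ l / (n : ℤ) then
    H (l / (n : ℤ) - s / (n : ℤ)).toNat (res n l) (res n s) else 0

/-- The infinite matrix `M_S`. -/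
def MS (n : ℕ) [NeZero n] (H : ℕ → Matrix (Fin n) (Fin n) ℂ) (S : SSet) : Matrix ℕ ℕ ℂ :=
  Matrix.of fun l m => blockToeplitz n H (l : ℤ) (S.1 m)

/-- The product of infinite matrices (all the sums used below have finitely many nonzero terms). -/
def infMul (A B : Matrix ℕ ℕ ℂ) : Matrix ℕ ℕ ℂ :=
  Matrix.of fun l m => ∑ᶠ p : ℕ, A l p * B p m

/-- The coefficients of the inverse of the formal power series `∑ k, H_k z ^ k`. -/
def invCoeff (n : ℕ) (H : ℕ → Matrix (Fin n) (Fin n) ℂ) (k : ℕ) : Matrix (Fin n) (Fin n) ℂ :=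
  PowerSeries.coeff k (Ring.inverse (PowerSeries.mk H))

/-- The matrix `M_0⁻¹`; see `MS_base_mul_M0inv` and `M0inv_mul_MS_base`. -/
def M0inv (n : ℕ) [NeZero n] (H : ℕ → Matrix (Fin n) (Fin n) ℂ) : Matrix ℕ ℕ ℂ :=
  MS n (invCoeff n H) SSet.base

/-- The matrix `M_S * M_0⁻¹`. -/
def schurMatrix (n : ℕ) [NeZero n] (H : ℕ → Matrix (Fin n) (Fin n) ℂ) (S : SSet) :
    Matrix ℕ ℕ ℂ :=
  infMul (MS n H S) (M0inv n H)

/-- The `n`-Schur function `f_S^n = det (M_S * M_0⁻¹)`. -/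
def nSchur (n : ℕ) [NeZero n] (H : ℕ → Matrix (Fin n) (Fin n) ℂ) (S : SSet) : ℂ :=
  infDet (schurMatrix n H S)

theorem sum_range_mul_eq (n : ℕ) [NeZero n] (L : ℕ) (f : ℕ → ℂ) :
    ∑ p ∈ Finset.range (n * L), f p = ∑ q ∈ Finset.range L, ∑ r : Fin n, f (n * q + r) := by
  induction L with
  | zero => simp
  | succ L ih =>
    rw [Finset.sum_range_succ, ← ih, Nat.mul_succ, Finset.sum_range_add, Finset.sum_range]
    simp [Finset.sum_range]

theorem res_block (n : ℕ) [NeZero n] (q : ℕ) (r : Fin n) :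
    res n (((n * q + r : ℕ) : ℤ)) = r := by
  apply Fin.ext
  have h : (((n * q + r : ℕ) : ℤ)) % (n : ℤ) = ((r : ℕ) : ℤ) := by
    rw [← Int.natCast_mod, Nat.mul_add_mod, Nat.mod_eq_of_lt r.2]
  simp only [res, h, Int.toNat_natCast]

theorem div_block (n : ℕ) [NeZero n] (q : ℕ) (r : Fin n) :
    (((n * q + r : ℕ) : ℤ)) / (n : ℤ) = (q : ℤ) := by
  rw [← Int.natCast_div, Nat.mul_add_div (Nat.pos_of_ne_zero (NeZero.ne n)),
    Nat.div_eq_of_lt r.2, add_zero]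

/-- Block Toeplitz matrices multiply like power series. -/
theorem infMul_MS_base (n : ℕ) [NeZero n] (A B C : ℕ → Matrix (Fin n) (Fin n) ℂ)
    (hC : PowerSeries.mk A * PowerSeries.mk B = PowerSeries.mk C) :
    infMul (MS n A SSet.base) (MS n B SSet.base) = MS n C SSet.base := by
  have hn : 0 < n := Nat.pos_of_ne_zero (NeZero.ne n)
  have hC' : ∀ k, C k = ∑ j ∈ Finset.range (k + 1), A (k - j) * B j := by
    intro k
    have := congrArg (PowerSeries.coeff k) hC
    rw [PowerSeries.coeff_mul] at this
    simp only [PowerSeries.coeff_mk] at this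
    rw [← this, ← Finset.Nat.sum_antidiagonal_swap,
      Finset.Nat.sum_antidiagonal_eq_sum_range_succ_mk]
    simp
  ext l m
  simp only [infMul, MS, SSet.base, Matrix.of_apply]
  rw [finsum_eq_sum_of_support_subset (s := Finset.range (n * (l / n + 1)))]
  · rw [sum_range_mul_eq]
    simp only [blockToeplitz, div_block, res_block]
    simp only [← Int.natCast_div, Nat.cast_le]
    set L := l / n
    set M := m / n
    by_cases hML : M ≤ L
    · rw [if_pos hML, show ((L : ℤ) - (M : ℤ)).toNat = L - M by omega, hC' (L - M),
        Matrix.sum_apply]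
      rw [show L + 1 = M + (L - M + 1) by omega, Finset.sum_range_add]
      rw [Finset.sum_eq_zero, zero_add]
      · refine Finset.sum_congr rfl fun j hj => ?_
        have hj' := Finset.mem_range.1 hj
        rw [Matrix.mul_apply]
        refine Finset.sum_congr rfl fun r _ => ?_
        rw [if_pos (by omega), if_pos (by omega),
          show ((L : ℤ) - ((M + j : ℕ) : ℤ)).toNat = L - M - j by omega,
          show (((M + j : ℕ) : ℤ) - (M : ℤ)).toNat = j by omega]
      · intro q hq
        have hq' := Finset.mem_range.1 hq
        refine Finset.sum_eq_zero fun r _ => ?_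
        rw [if_neg (show ¬ M ≤ q by omega), mul_zero]
    · rw [if_neg hML]
      refine Finset.sum_eq_zero fun q hq => Finset.sum_eq_zero fun r _ => ?_
      have hq' := Finset.mem_range.1 hq
      rw [if_neg (show ¬ M ≤ q by omega), mul_zero]
  · intro p hp
    by_contra hp'
    simp only [Finset.coe_range, Set.mem_Iio, not_lt] at hp'
    have h1 : l / n + 1 ≤ p / n := by
      rw [Nat.le_div_iff_mul_le hn, mul_comm]; exact hp'
    apply hp
    simp only [blockToeplitz]
    simp only [← Int.natCast_div, Nat.cast_le]
    rw [if_neg (show ¬ p / n ≤ l / n by omega), zero_mul]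

theorem MS_base_one (n : ℕ) [NeZero n] :
    MS n (fun k => PowerSeries.coeff k 1) SSet.base = 1 := by
  ext l m
  have hd := Nat.div_add_mod l n
  have hd' := Nat.div_add_mod m n
  simp only [MS, SSet.base, Matrix.of_apply, blockToeplitz, PowerSeries.coeff_one]
  simp only [← Int.natCast_div, Nat.cast_le]
  by_cases h : l = m
  · subst h; simp
  · rw [Matrix.one_apply_ne h]
    by_cases hML : m / n ≤ l / n
    · rw [if_pos hML]
      by_cases h2 : l / n = m / n
      · rw [if_pos (by omega), Matrix.one_apply_ne]
        intro h3
        have h4 := congrArg Fin.val h3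
        simp only [res, ← Int.natCast_mod, Int.toNat_natCast] at h4
        rw [h2, h4] at hd
        omega
      · rw [if_neg (by omega)]; rfl
    · rw [if_neg hML]

theorem isUnit_mk (n : ℕ) {H : ℕ → Matrix (Fin n) (Fin n) ℂ} (h : IsUnit (H 0)) :
    IsUnit (PowerSeries.mk H) := by
  have h0 : PowerSeries.constantCoeff (PowerSeries.mk H) = (h.unit : Matrix (Fin n) (Fin n) ℂ) := by
    rw [← PowerSeries.coeff_zero_eq_constantCoeff_apply, PowerSeries.coeff_mk]; rfl
  exact ⟨⟨_, _, PowerSeries.mul_invOfUnit _ h.unit h0, PowerSeries.invOfUnit_mul _ h.unit h0⟩, rfl⟩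

theorem mk_invCoeff (n : ℕ) (H : ℕ → Matrix (Fin n) (Fin n) ℂ) :
    PowerSeries.mk (invCoeff n H) = Ring.inverse (PowerSeries.mk H) := by
  ext1 k; simp [invCoeff]

theorem MS_base_mul_M0inv (n : ℕ) [NeZero n] {H : ℕ → Matrix (Fin n) (Fin n) ℂ}
    (h : IsUnit (H 0)) : infMul (MS n H SSet.base) (M0inv n H) = 1 := by
  rw [← MS_base_one n]
  apply infMul_MS_base
  rw [mk_invCoeff, Ring.mul_inverse_cancel _ (isUnit_mk n h)]
  ext1 k; simp

theorem M0inv_mul_MS_base (n : ℕ) [NeZero n] {H : ℕ → Matrix (Fin n) (Fin n) ℂ}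
    (h : IsUnit (H 0)) : infMul (M0inv n H) (MS n H SSet.base) = 1 := by
  rw [← MS_base_one n]
  apply infMul_MS_base
  rw [mk_invCoeff, Ring.inverse_mul_cancel _ (isUnit_mk n h)]
  ext1 k; simp

/-! ### The action of a matrix function -/

/-- A matrix-valued function `g z = ∑ k, H_k z ^ k` (with `H_k = g.coeff k`), given by a power
series that converges on a neighbourhood of the closed unit disc, such that `g z` is invertible
for all `z` in the closed unit disc. -/
structure MatrixFun (n : ℕ) where
  coeff : ℕ → Matrix (Fin n) (Fin n) ℂ
  summable : ∃ R : ℝ, 1 < R ∧ ∀ z : ℂ, ‖z‖ < R → Summable fun k : ℕ => z ^ k • coeff k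
  isUnit : ∀ z : ℂ, ‖z‖ ≤ 1 → IsUnit (∑' k : ℕ, z ^ k • coeff k)

/-- The value `g z`. -/
def MatrixFun.eval {n : ℕ} (g : MatrixFun n) (z : ℂ) : Matrix (Fin n) (Fin n) ℂ :=
  ∑' k : ℕ, z ^ k • g.coeff k

theorem norm_zc (t : Torus) : ‖zc t‖ = 1 := Circle.norm_coe _

theorem MatrixFun.continuous_eval_zc {n : ℕ} (g : MatrixFun n) :
    Continuous fun t : Torus => g.eval (zc t) := by
  obtain ⟨R, hR, hs⟩ := g.summable
  have hz : Continuous zc := continuous_subtype_val.comp AddCircle.continuous_toCircle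
  refine continuous_matrix fun i j => ?_
  have h1 : Summable fun k => ‖g.coeff k i j‖ := by
    have := hs 1 (by simpa using hR)
    simp only [one_pow, one_smul] at this
    exact ((Pi.summable.1 ((Pi.summable.1 this) i)) j).norm
  have h2 : ∀ t : Torus, g.eval (zc t) i j = ∑' k : ℕ, zc t ^ k * g.coeff k i j := by
    intro t
    have h3 := (hs (zc t) (by rw [norm_zc]; exact hR))
    have h4 := Pi.hasSum.1 (Pi.hasSum.1 h3.hasSum i) j
    exact h4.tsum_eq.symm
  simp only [h2]
  refine continuous_tsum (fun k => (hz.pow k).mul continuous_const) h1 fun k t => ?_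
  simp [norm_zc]

/-- The restriction of `g` to the circle, with matrices acting on `ℂⁿ` as linear maps. -/
def MatrixFun.onCircle {n : ℕ} (g : MatrixFun n) :
    C(Torus, EuclideanSpace ℂ (Fin n) →L[ℂ] EuclideanSpace ℂ (Fin n)) where
  toFun t := Matrix.toEuclideanCLM (n := Fin n) (𝕜 := ℂ) (g.eval (zc t))
  continuous_toFun :=
    (LinearMap.continuous_of_finiteDimensional
      ((Matrix.toEuclideanCLM (n := Fin n) (𝕜 := ℂ)).toAlgEquiv.toLinearMap)).comp
      g.continuous_eval_zc

/-- Multiplication by `g`, as an operator on `H^n`. -/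
def MatrixFun.mulOp {n : ℕ} (g : MatrixFun n) : HS n →L[ℂ] HS n :=
  (ContinuousLinearMap.id ℂ (EuclideanSpace ℂ (Fin n) →L[ℂ] EuclideanSpace ℂ (Fin n))).holderL
    AddCircle.haarAddCircle ⊤ 2 2
    (ContinuousMap.toLp ⊤ AddCircle.haarAddCircle ℂ g.onCircle)

/-- `(g f)(z) = g(z) f(z)` for almost every `z` on the circle. -/
theorem MatrixFun.mulOp_apply {n : ℕ} (g : MatrixFun n) (f : HS n) :
    ∀ᵐ t ∂(AddCircle.haarAddCircle : Measure Torus),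
      (g.mulOp f : Torus → EuclideanSpace ℂ (Fin n)) t =
        WithLp.toLp 2 ((g.eval (zc t)).mulVec (WithLp.ofLp (f t))) := by
  have h1 := ContinuousLinearMap.coeFn_holder (r := 2)
    (ContinuousLinearMap.id ℂ (EuclideanSpace ℂ (Fin n) →L[ℂ] EuclideanSpace ℂ (Fin n)))
    (ContinuousMap.toLp ⊤ AddCircle.haarAddCircle ℂ g.onCircle) f
  have h2 := ContinuousMap.coeFn_toLp (𝕜 := ℂ) (p := ⊤)
    (AddCircle.haarAddCircle : Measure Torus) g.onCircle
  filter_upwards [h1, h2] with t ht1 ht2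
  refine ht1.trans ?_
  rw [ht2]
  rfl

/-- The compression `a` of multiplication by `g` to `H^n_+`. -/
def MatrixFun.opA {n : ℕ} [NeZero n] (g : MatrixFun n) : HPlus n →L[ℂ] HPlus n :=
  prPlus n ∘L g.mulOp ∘L (HPlus n).subtypeL

/-- The frame `g w a⁻¹`. -/
def MatrixFun.act {n : ℕ} [NeZero n] (g : MatrixFun n) (w : HPlus n →L[ℂ] HS n) :
    HPlus n →L[ℂ] HS n :=
  g.mulOp ∘L w ∘L Ring.inverse g.opA

end NSchur

namespace NSchur

/-! ### Hadamard's inequality and perturbation bounds for determinants -/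

section Hadamard

variable {ι κ : Type*} [Fintype ι] [DecidableEq ι] [Fintype κ] [DecidableEq κ]

/-! Write $A=a^{-1}\mathrm{pr}_+g$, as a matrix with rows $l\ge 0$ and columns $s\in\mathbb Z$.
Since $g$ has no negative Fourier coefficients, it maps $H^n_+$ to itself and $a$ is its
restriction; the same holds for $g^{-1}$, so $a$ is invertible and $A=[\,1\mid c\,]$ with the
identity in the columns $s\ge 0$. Determinants of the form $1+$ trace class do not change under
conjugation by $a$. Hence $\langle 0|gwa^{-1}\rangle=\det(a^{-1}\mathrm{pr}_+gw)=\det(Aw)$, and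
$f_S^n$ is the minor of $A$ in the columns $S$. The expansion is therefore the Cauchy-Binet formula
for the product $Aw$.

The analytic content is the passage to infinite size. For an $N\times N$ block of $Aw$ the
nonnegative columns of $A$ are unit vectors, so finite Cauchy-Binet gives a sum over those $S$ with
$s_j=j$ for $j\ge N$ (after a limit over the negative indices). Dominated convergence over $S$ then
lets $N\to\infty$. The majorant comes from Hadamard's inequality: a minor of $A$ is bounded by a
product over the negative terms and the gaps of $S$ (`norm_det_columns_le`), because convergence of
$g$ and $g^{-1}$ beyond the unit circle makes $c$ decay geometrically in both indices; a minor of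
$w$ is bounded by a constant times a power of $\max(1,\|w\|)$ (`norm_det_rows_le`). The product is
summable over pairs of finite sets (`hasSum_infinite_cauchyBinet`).

Existence and conjugation invariance of the determinants follow from $\det(1+YX)=\det(1+XY)$: the
block determinants of $1+\sum_k\langle x_k,\cdot\rangle y_k$ have the same limit as the Gram type
determinants $\det(1+(\langle x_j,y_k\rangle))$ (`exists_hasInfDet_gram`). The frame property of
$gwa^{-1}$ rests on the Hankel operator $\mathrm{pr}_+g\,\mathrm{pr}_-$ being of trace class and on
$1+$ trace class being Fredholm of index zero. -/

open scoped ComplexOrder in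
theorem norm_det_le_one_of_unit_rows (A : Matrix ι ι ℂ) (h : ∀ i, ∑ j, ‖A i j‖ ^ 2 = 1) :
    ‖A.det‖ ≤ 1 := by
  have hP := Matrix.posSemidef_self_mul_conjTranspose A
  have hdet : ((‖A.det‖ ^ 2 : ℝ) : ℂ) = ∏ i, ((hP.1.eigenvalues i : ℝ) : ℂ) := by
    have := hP.1.det_eq_prod_eigenvalues
    rw [Matrix.det_mul, Matrix.det_conjTranspose] at this
    rw [Complex.ofReal_pow, ← Complex.mul_conj']
    exact this
  have htr : (Fintype.card ι : ℂ) = ∑ i, ((hP.1.eigenvalues i : ℝ) : ℂ) := by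
    have := hP.1.trace_eq_sum_eigenvalues
    refine Eq.trans ?_ this
    have h1 : ∀ i, (A * A.conjTranspose) i i = 1 := by
      intro i
      rw [Matrix.mul_apply]
      have : ∀ j, A i j * A.conjTranspose j i = ((‖A i j‖ ^ 2 : ℝ) : ℂ) := by
        intro j
        rw [Matrix.conjTranspose_apply, Complex.ofReal_pow, ← Complex.mul_conj']
        rfl
      simp only [this]
      rw [← Complex.ofReal_sum, h i, Complex.ofReal_one]
    simp [Matrix.trace, h1]
  have hdet' : ‖A.det‖ ^ 2 = ∏ i, hP.1.eigenvalues i := by exact_mod_cast hdet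
  have htr' : (Fintype.card ι : ℝ) = ∑ i, hP.1.eigenvalues i := by exact_mod_cast htr
  have h2 : ‖A.det‖ ^ 2 ≤ 1 := by
    rw [hdet']
    -- The eigenvalues of $AA^*$ are nonnegative with mean 1; $t\le e^{t-1}$ replaces the inequality
    -- of arithmetic and geometric means.
    calc ∏ i, hP.1.eigenvalues i ≤ ∏ i, Real.exp (hP.1.eigenvalues i - 1) := by
          refine Finset.prod_le_prod (fun i _ => hP.eigenvalues_nonneg i) fun i _ => ?_
          have := Real.add_one_le_exp (hP.1.eigenvalues i - 1)
          linarith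
      _ = 1 := by
          rw [← Real.exp_sum, Finset.sum_sub_distrib, ← htr']
          simp
  exact (sq_le_one_iff₀ (norm_nonneg _)).1 h2

/-- Hadamard's inequality for the rows of a complex matrix. -/
theorem norm_det_le_prod_rows (A : Matrix ι ι ℂ) :
    ‖A.det‖ ≤ ∏ i, √(∑ j, ‖A i j‖ ^ 2) := by
  by_cases h : ∃ i, ∑ j, ‖A i j‖ ^ 2 = 0
  · obtain ⟨i, hi⟩ := h
    rw [Finset.sum_eq_zero_iff_of_nonneg (fun _ _ => by positivity)] at hi
    rw [Matrix.det_eq_zero_of_row_eq_zero i fun j => by simpa using hi j (Finset.mem_univ j),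
      norm_zero]
    exact Finset.prod_nonneg fun _ _ => Real.sqrt_nonneg _
  push Not at h
  set r : ι → ℝ := fun i => √(∑ j, ‖A i j‖ ^ 2)
  have hr : ∀ i, 0 < r i := fun i => Real.sqrt_pos.2
    (lt_of_le_of_ne (Finset.sum_nonneg fun _ _ => by positivity) (h i).symm)
  set A' : Matrix ι ι ℂ := Matrix.of fun i j => ((r i)⁻¹ : ℂ) * A i j
  have hA' : ‖A'.det‖ ≤ 1 := by
    refine norm_det_le_one_of_unit_rows A' fun i => ?_
    have h1 : ∀ j, ‖A' i j‖ ^ 2 = (r i ^ 2)⁻¹ * ‖A i j‖ ^ 2 := by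
      intro j
      simp only [A', Matrix.of_apply, norm_mul, norm_inv, Complex.norm_real, Real.norm_eq_abs,
        abs_of_pos (hr i)]
      ring
    simp only [h1]
    rw [← Finset.mul_sum, Real.sq_sqrt (Finset.sum_nonneg fun _ _ => by positivity)]
    exact inv_mul_cancel₀ (h i)
  rw [Matrix.det_mul_column, norm_mul, norm_prod] at hA'
  have h2 : ∏ i, ‖((r i)⁻¹ : ℂ)‖ = (∏ i, r i)⁻¹ := by
    rw [← Finset.prod_inv_distrib]
    exact Finset.prod_congr rfl fun i _ => by
      rw [norm_inv, Complex.norm_real, Real.norm_eq_abs, abs_of_pos (hr i)]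
  rw [h2, inv_mul_le_iff₀ (Finset.prod_pos fun i _ => hr i), mul_one] at hA'
  exact hA'

/-- Turns each row factor of Hadamard's inequality into an exponential, so that the product over
rows becomes the exponential of a sum of squares. -/
theorem sqrt_sq_add_le {b s : ℝ} (hb : 1 ≤ b) (hs : 0 ≤ s) : √(b ^ 2 + s) ≤ b * Real.exp s := by
  rw [Real.sqrt_le_left (by positivity)]
  have h1 := Real.add_one_le_exp s
  have h2 : 1 + s ≤ Real.exp s ^ 2 := by nlinarith
  rw [mul_pow]
  nlinarith [mul_le_mul_of_nonneg_left h2 (sq_nonneg b), mul_nonneg (show 0 ≤ b ^ 2 - 1 by nlinarith) hs]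

/-- A bound for the determinant of `B + Y * X` that is uniform in the sizes of the matrices. -/
theorem norm_det_add_mul_le (B : Matrix ι ι ℂ) (Y : Matrix ι κ ℂ) (X : Matrix κ ι ℂ) (β : ι → ℝ)
    (hβ : ∀ i, 1 ≤ β i) (hB : ∀ i, ∑ j, ‖B i j‖ ^ 2 ≤ β i ^ 2) :
    ‖(B + Y * X).det‖ ≤ (∏ i, β i) *
      Real.exp ((∑ i, ∑ k, ‖Y i k‖ ^ 2) + ∑ k, ∑ i, ‖X k i‖ ^ 2) := by
  -- $B+YX$ is a Schur complement. In the larger matrix the entries of $Y$ and $X$ occur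
  -- unmultiplied, so Hadamard's inequality sees only their square sums.
  have h1 : (B + Y * X).det = (Matrix.fromBlocks B (-Y) X 1).det := by
    rw [Matrix.det_fromBlocks_one₂₂, Matrix.neg_mul, sub_neg_eq_add]
  rw [h1]
  refine (norm_det_le_prod_rows _).trans ?_
  rw [Fintype.prod_sum_type, Real.exp_add, Real.exp_sum, Real.exp_sum, ← mul_assoc,
    ← Finset.prod_mul_distrib]
  refine mul_le_mul ?_ ?_ (Finset.prod_nonneg fun _ _ => Real.sqrt_nonneg _)
    (Finset.prod_nonneg fun i _ => mul_nonneg (zero_le_one.trans (hβ i)) (Real.exp_nonneg _))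
  · refine Finset.prod_le_prod (fun _ _ => Real.sqrt_nonneg _) fun i _ => ?_
    refine le_trans (Real.sqrt_le_sqrt ?_)
      (sqrt_sq_add_le (hβ i) (Finset.sum_nonneg fun _ _ => by positivity))
    simp only [Fintype.sum_sum_type, Matrix.fromBlocks_apply₁₁, Matrix.fromBlocks_apply₁₂,
      Matrix.neg_apply, norm_neg]
    linarith [hB i]
  · refine Finset.prod_le_prod (fun _ _ => Real.sqrt_nonneg _) fun k _ => ?_
    refine le_trans (Real.sqrt_le_sqrt ?_) ((sqrt_sq_add_le (le_refl 1)
      (Finset.sum_nonneg fun i _ => by positivity : 0 ≤ ∑ i, ‖X k i‖ ^ 2)).trans_eq (one_mul _))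
    have h2 : ∑ j, ‖(1 : Matrix κ κ ℂ) k j‖ ^ 2 = 1 := by
      simp [Matrix.one_apply, apply_ite]
    simp only [Fintype.sum_sum_type, Matrix.fromBlocks_apply₂₁, Matrix.fromBlocks_apply₂₂, h2]
    linarith

/-- Along a rank one direction the determinant is affine in $t$: bordering $M$ by the column $-y$
and the row $(tx,1)$ puts $t$ into a single row. -/
theorem det_add_smul_vecMulVec (M : Matrix ι ι ℂ) (y x : ι → ℂ) (t : ℂ) :
    (M + t • Matrix.vecMulVec y x).det =
      M.det + t * ((M + Matrix.vecMulVec y x).det - M.det) := by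
  set Z : (ι ⊕ Unit → ℂ) → Matrix (ι ⊕ Unit) (ι ⊕ Unit) ℂ := fun r =>
    (Matrix.fromBlocks M (-Matrix.replicateCol Unit y) 0 0).updateRow (Sum.inr ()) r
  have hZ : ∀ v : ι → ℂ, (M + Matrix.vecMulVec y v).det =
      (Z (Sum.elim v (fun _ => 0))).det + (Z (Sum.elim (0 : ι → ℂ) (fun _ => 1))).det := by
    intro v
    rw [← Matrix.det_updateRow_add]
    have h1 : (Matrix.fromBlocks M (-Matrix.replicateCol Unit y) 0 0).updateRow (Sum.inr ())
        (Sum.elim v (fun _ => 0) + Sum.elim (0 : ι → ℂ) (fun _ => 1)) =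
        Matrix.fromBlocks M (-Matrix.replicateCol Unit y) (Matrix.replicateRow Unit v) 1 := by
      ext i j
      rcases i with i | i <;> rcases j with j | j <;> simp [Matrix.updateRow_apply]
    rw [h1, Matrix.det_fromBlocks_one₂₂, Matrix.neg_mul, sub_neg_eq_add,
      ← Matrix.vecMulVec_eq]
  have h0 := hZ 0
  have h1 := hZ x
  have ht := hZ (t • x)
  have e0 : (Z (Sum.elim (0 : ι → ℂ) (fun _ => 0))).det = 0 :=
    Matrix.det_eq_zero_of_row_eq_zero (Sum.inr ()) fun j => by rcases j with j | j <;> simp [Z]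
  have et : (Z (Sum.elim (t • x) (fun _ => 0))).det = t * (Z (Sum.elim x (fun _ => 0))).det := by
    rw [← Matrix.det_updateRow_smul]
    congr 2
    ext j
    rcases j with j | j <;> simp
  rw [Matrix.vecMulVec_zero, add_zero, e0, zero_add] at h0
  rw [← Matrix.vecMulVec_smul, ht, h1, et, h0]
  ring

/-- Rank one perturbations of a determinant, bounded by scaling to unit vectors. -/
theorem norm_det_add_vecMulVec_sub_le (M : Matrix ι ι ℂ) (C : ℝ)
    (hC : ∀ y x : ι → ℂ, ∑ i, ‖y i‖ ^ 2 ≤ 1 → ∑ i, ‖x i‖ ^ 2 ≤ 1 →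
      ‖(M + Matrix.vecMulVec y x).det‖ ≤ C) (y x : ι → ℂ) (p q : ℝ) (hp : 0 ≤ p) (hq : 0 ≤ q)
    (hy : ∑ i, ‖y i‖ ^ 2 ≤ p ^ 2) (hx : ∑ i, ‖x i‖ ^ 2 ≤ q ^ 2) :
    ‖(M + Matrix.vecMulVec y x).det - M.det‖ ≤ 2 * C * (p * q) := by
  have hM : ‖M.det‖ ≤ C := by simpa using hC 0 0 (by simp) (by simp)
  have key : ∀ (y : ι → ℂ) (p : ℝ), 0 ≤ p → ∑ i, ‖y i‖ ^ 2 ≤ p ^ 2 →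
      ∃ y' : ι → ℂ, y = (p : ℂ) • y' ∧ ∑ i, ‖y' i‖ ^ 2 ≤ 1 := by
    intro y p hp hy
    rcases hp.eq_or_lt with h0 | h0
    · refine ⟨0, ?_, by simp⟩
      rw [← h0] at hy
      have : ∑ i, ‖y i‖ ^ 2 = 0 :=
        le_antisymm (by simpa using hy) (Finset.sum_nonneg fun _ _ => by positivity)
      rw [Finset.sum_eq_zero_iff_of_nonneg (fun _ _ => by positivity)] at this
      ext i
      simpa using this i (Finset.mem_univ i)
    · refine ⟨(p : ℂ)⁻¹ • y, ?_, ?_⟩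
      · rw [smul_smul, mul_inv_cancel₀ (by exact_mod_cast h0.ne'), one_smul]
      · simp only [Pi.smul_apply, smul_eq_mul, norm_mul, norm_inv, Complex.norm_real,
          Real.norm_eq_abs, abs_of_pos h0, mul_pow, ← Finset.mul_sum]
        rw [inv_pow, inv_mul_le_iff₀ (by positivity), mul_one]
        exact hy
  obtain ⟨y', rfl, hy'⟩ := key y p hp hy
  obtain ⟨x', rfl, hx'⟩ := key x q hq hx
  -- With $y=py'$ and $x=qx'$ the difference is exactly $pq$ times the difference for the vectors
  -- $y',x'$ of norm at most 1, where both determinants are bounded by $C$.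
  rw [Matrix.smul_vecMulVec, Matrix.vecMulVec_smul, smul_smul, det_add_smul_vecMulVec,
    add_sub_cancel_left, norm_mul]
  have h1 : ‖((p : ℂ) * (q : ℂ))‖ = p * q := by
    rw [norm_mul, Complex.norm_real, Complex.norm_real, Real.norm_of_nonneg hp,
      Real.norm_of_nonneg hq]
  rw [h1, mul_comm]
  refine mul_le_mul_of_nonneg_right ?_ (by positivity)
  have := (norm_sub_le (M + Matrix.vecMulVec y' x').det M.det)
  linarith [hC y' x' hy' hx']

end Hadamard

/-! ### Interchange of limits -/

/-- Telescoping in $K$ writes both iterated limits as sums of increments; the majorant `β`, uniform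
in $N$, permits dominated convergence. -/
theorem exists_tendsto_of_summable_increments {u : ℕ → ℕ → ℂ} {d D : ℕ → ℂ} {β : ℕ → ℝ}
    (hβ : Summable β) (hu : ∀ N K, ‖u N (K + 1) - u N K‖ ≤ β K)
    (hd : ∀ N, Tendsto (u N) atTop (𝓝 (d N)))
    (hD : ∀ K, Tendsto (fun N => u N K) atTop (𝓝 (D K))) :
    ∃ L, Tendsto d atTop (𝓝 L) ∧ Tendsto D atTop (𝓝 L) := by
  have hD' : ∀ K, ‖D (K + 1) - D K‖ ≤ β K := fun K =>
    le_of_tendsto ((hD (K + 1)).sub (hD K)).norm (Eventually.of_forall fun N => hu N K)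
  have hlim := tendsto_tsum_of_dominated_convergence (𝓕 := atTop) hβ
    (fun K => (hD (K + 1)).sub (hD K)) (Eventually.of_forall fun N K => hu N K)
  have h1 : ∀ N, d N = (∑' K, (u N (K + 1) - u N K)) + u N 0 := by
    intro N
    have hs : Summable fun K => u N (K + 1) - u N K := Summable.of_norm_bounded hβ (hu N)
    have := hs.hasSum.tendsto_sum_nat
    simp only [Finset.sum_range_sub] at this
    rw [tendsto_nhds_unique this ((hd N).sub_const _)]
    ring
  refine ⟨(∑' K, (D (K + 1) - D K)) + D 0, ?_, ?_⟩
  · exact (hlim.add (hD 0)).congr fun N => (h1 N).symm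
  · have hs : Summable fun K => D (K + 1) - D K := Summable.of_norm_bounded hβ hD'
    have := hs.hasSum.tendsto_sum_nat
    simp only [Finset.sum_range_sub] at this
    simpa using this.add_const (D 0)

/-! ### Operators of trace class -/

section TraceClass

variable {E F G : Type*} [NormedAddCommGroup E] [InnerProductSpace ℂ E]
  [NormedAddCommGroup F] [InnerProductSpace ℂ F] [NormedAddCommGroup G] [InnerProductSpace ℂ G]

theorem IsTraceClass.add {S T : E →L[ℂ] F} (hS : IsTraceClass S) (hT : IsTraceClass T) :
    IsTraceClass (S + T) := by
  obtain ⟨x, y, h1, h2⟩ := hS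
  obtain ⟨x', y', h1', h2'⟩ := hT
  let φ := Equiv.natSumNatEquivNat
  refine ⟨Sum.elim x x' ∘ φ.symm, Sum.elim y y' ∘ φ.symm, ?_, fun v => ?_⟩
  · refine (φ.symm.summable_iff (f := fun s => ‖Sum.elim x x' s‖ * ‖Sum.elim y y' s‖)).2 ?_
    exact (HasSum.sum (f := fun s => ‖Sum.elim x x' s‖ * ‖Sum.elim y y' s‖)
      h1.hasSum h1'.hasSum).summable
  · refine (φ.symm.hasSum_iff
      (f := fun s => (inner ℂ (Sum.elim x x' s) v : ℂ) • Sum.elim y y' s)).2 ?_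
    exact HasSum.sum (h2 v) (h2' v)

theorem IsTraceClass.clm_comp {T : E →L[ℂ] F} (hT : IsTraceClass T) (A : F →L[ℂ] G) :
    IsTraceClass (A ∘L T) := by
  obtain ⟨x, y, h1, h2⟩ := hT
  refine ⟨x, fun k => A (y k), ?_, fun v => ?_⟩
  · refine Summable.of_nonneg_of_le (fun _ => by positivity) (fun k => ?_) (h1.mul_left ‖A‖)
    calc ‖x k‖ * ‖A (y k)‖ ≤ ‖x k‖ * (‖A‖ * ‖y k‖) :=
          mul_le_mul_of_nonneg_left (A.le_opNorm _) (norm_nonneg _)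
      _ = ‖A‖ * (‖x k‖ * ‖y k‖) := by ring
  · simpa using (h2 v).mapL A

theorem IsTraceClass.comp_clm [CompleteSpace E] [CompleteSpace G] {T : E →L[ℂ] F}
    (hT : IsTraceClass T) (A : G →L[ℂ] E) : IsTraceClass (T ∘L A) := by
  obtain ⟨x, y, h1, h2⟩ := hT
  refine ⟨fun k => ContinuousLinearMap.adjoint A (x k), y, ?_, fun v => ?_⟩
  · refine Summable.of_nonneg_of_le (fun _ => by positivity) (fun k => ?_)
      (h1.mul_left ‖ContinuousLinearMap.adjoint A‖)
    calc ‖ContinuousLinearMap.adjoint A (x k)‖ * ‖y k‖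
        ≤ (‖ContinuousLinearMap.adjoint A‖ * ‖x k‖) * ‖y k‖ :=
          mul_le_mul_of_nonneg_right (ContinuousLinearMap.le_opNorm _ _) (norm_nonneg _)
      _ = _ := by ring
  · simpa [ContinuousLinearMap.adjoint_inner_left] using h2 (A v)

theorem isTraceClass_rankOne (x : E) (y : F) :
    IsTraceClass ((innerSL ℂ x).smulRight y) := by
  refine ⟨fun k => if k = 0 then x else 0, fun k => if k = 0 then y else 0, ?_, fun v => ?_⟩
  · exact summable_of_ne_finset_zero (s := {0}) fun k hk => by simp_all
  · convert hasSum_single (f := fun k : ℕ => (inner ℂ (if k = 0 then x else 0) v : ℂ) •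
      (if k = 0 then y else 0)) 0 (fun k hk => by simp [hk]) using 1
    simp

theorem isTraceClass_zero : IsTraceClass (0 : E →L[ℂ] F) := by
  simpa using isTraceClass_rankOne (0 : E) (0 : F)

theorem isTraceClass_sum {ι : Type*} (s : Finset ι) {T : ι → E →L[ℂ] F}
    (h : ∀ i ∈ s, IsTraceClass (T i)) : IsTraceClass (∑ i ∈ s, T i) := by
  classical
  induction s using Finset.induction_on with
  | empty => simpa using isTraceClass_zero
  | insert i s hi ih =>
    rw [Finset.sum_insert hi]
    exact (h i (Finset.mem_insert_self _ _)).add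
      (ih fun j hj => h j (Finset.mem_insert_of_mem hj))

/-- The vectors representing an operator of trace class can be chosen square summable. -/
theorem IsTraceClass.exists_balanced {T : E →L[ℂ] F} (hT : IsTraceClass T) :
    ∃ (x : ℕ → E) (y : ℕ → F) (α : ℕ → ℝ), Summable α ∧ (∀ k, ‖x k‖ ^ 2 ≤ α k) ∧
      (∀ k, ‖y k‖ ^ 2 ≤ α k) ∧ ∀ v, HasSum (fun k => (inner ℂ (x k) v : ℂ) • y k) (T v) := by
  obtain ⟨x, y, h1, h2⟩ := hT
  have key : ∀ k, ∃ (x' : E) (y' : F), ‖x'‖ ^ 2 ≤ ‖x k‖ * ‖y k‖ ∧ ‖y'‖ ^ 2 ≤ ‖x k‖ * ‖y k‖ ∧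
      ∀ v, (inner ℂ x' v : ℂ) • y' = (inner ℂ (x k) v : ℂ) • y k := by
    intro k
    rcases eq_or_ne (x k) 0 with hx | hx
    · exact ⟨0, 0, by simp [hx], by simp [hx], fun v => by simp [hx]⟩
    rcases eq_or_ne (y k) 0 with hy | hy
    · exact ⟨0, 0, by simp [hy], by simp [hy], fun v => by simp [hy]⟩
    have hx' : 0 < ‖x k‖ := norm_pos_iff.2 hx
    have hy' : 0 < ‖y k‖ := norm_pos_iff.2 hy
    -- Replacing $(x,y)$ by $(cx,c^{-1}y)$ keeps the rank one operator; this $c$ makes both squared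
    -- norms equal to $\|x\|\|y\|$.
    set c : ℝ := √(‖y k‖ / ‖x k‖)
    have hc : 0 < c := Real.sqrt_pos.2 (by positivity)
    have hc2 : c ^ 2 = ‖y k‖ / ‖x k‖ := Real.sq_sqrt (by positivity)
    refine ⟨(c : ℂ) • x k, (c : ℂ)⁻¹ • y k, ?_, ?_, fun v => ?_⟩
    · rw [norm_smul, Complex.norm_real, Real.norm_of_nonneg hc.le, mul_pow, hc2]
      apply le_of_eq
      field_simp
    · rw [norm_smul, norm_inv, Complex.norm_real, Real.norm_of_nonneg hc.le, mul_pow, inv_pow, hc2]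
      apply le_of_eq
      field_simp
    · have : (c : ℂ) ≠ 0 := by exact_mod_cast hc.ne'
      rw [inner_smul_left, Complex.conj_ofReal, smul_smul]
      congr 1
      field_simp
  choose x' y' hx' hy' hxy using key
  exact ⟨x', y', _, h1, hx', hy', fun v => by simpa only [hxy] using h2 v⟩

end TraceClass

/-! ### Determinants of operators -/

section

variable {ι κ : Type*} [Fintype ι] [DecidableEq ι] [Fintype κ] [DecidableEq κ]

/-- A rank one term appends a column to $Y$ and a row to $X$. For vectors of norm at most 1 each
square sum grows by at most 1, whence the exponent $2S+2$. -/
theorem norm_det_one_add_mul_add_vecMulVec_sub_le (Y : Matrix ι κ ℂ) (X : Matrix κ ι ℂ) (S : ℝ)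
    (hY : ∑ k, ∑ i, ‖Y i k‖ ^ 2 ≤ S) (hX : ∑ k, ∑ i, ‖X k i‖ ^ 2 ≤ S) (y x : ι → ℂ) (p q : ℝ)
    (hp : 0 ≤ p) (hq : 0 ≤ q) (hy : ∑ i, ‖y i‖ ^ 2 ≤ p ^ 2) (hx : ∑ i, ‖x i‖ ^ 2 ≤ q ^ 2) :
    ‖(1 + Y * X + Matrix.vecMulVec y x).det - (1 + Y * X).det‖ ≤
      2 * Real.exp (2 * S + 2) * (p * q) := by
  refine norm_det_add_vecMulVec_sub_le _ _ (fun y x hy hx => ?_) y x p q hp hq hy hx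
  have h1 : 1 + Y * X + Matrix.vecMulVec y x = 1 + Matrix.fromCols Y (Matrix.replicateCol Unit y) *
      Matrix.fromRows X (Matrix.replicateRow Unit x) := by
    rw [Matrix.fromCols_mul_fromRows, Matrix.vecMulVec_eq Unit, add_assoc]
  rw [h1]
  refine (norm_det_add_mul_le _ _ _ (fun _ => 1) (fun _ => le_rfl) fun i => ?_).trans ?_
  · simp [Matrix.one_apply, apply_ite]
  · rw [Finset.prod_const_one, one_mul]
    refine Real.exp_le_exp.2 ?_
    rw [Finset.sum_comm]
    simp only [Fintype.sum_sum_type, Matrix.fromCols_apply_inl, Matrix.fromCols_apply_inr,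
      Matrix.fromRows_apply_inl, Matrix.fromRows_apply_inr, Matrix.replicateCol_apply,
      Matrix.replicateRow_apply, Finset.univ_unique, Finset.sum_const, Finset.card_singleton,
      one_smul]
    linarith

end

section Fredholm

variable {E : Type*} [NormedAddCommGroup E] [InnerProductSpace ℂ E]

/-- The matrix of an operator in a Hilbert basis. -/
def opMatrix (b : HilbertBasis ℕ ℂ E) (R : E →L[ℂ] E) : Matrix ℕ ℕ ℂ :=
  Matrix.of fun l m => (inner ℂ (b l) (R (b m)) : ℂ)

theorem opMatrix_eq (b : HilbertBasis ℕ ℂ E) (R : E →L[ℂ] E) (l m : ℕ) :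
    opMatrix b R l m = (if l = m then 1 else 0) +
      (inner ℂ (b l) ((R - ContinuousLinearMap.id ℂ E) (b m)) : ℂ) := by
  simp only [opMatrix, Matrix.of_apply, sub_apply, ContinuousLinearMap.id_apply, inner_sub_right]
  rw [orthonormal_iff_ite.1 b.orthonormal l m]
  ring

theorem tendsto_det {n : Type*} [Fintype n] [DecidableEq n] {f : ℕ → Matrix n n ℂ}
    {A : Matrix n n ℂ} (h : ∀ i j, Tendsto (fun k => f k i j) atTop (𝓝 (A i j))) :
    Tendsto (fun k => (f k).det) atTop (𝓝 A.det) :=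
  ((continuous_id.matrix_det (n := n) (R := ℂ)).tendsto A).comp
    (tendsto_pi_nhds.2 fun i => tendsto_pi_nhds.2 fun j => h i j)

theorem sum_fin_norm_inner_sq_le (b : HilbertBasis ℕ ℂ E) (N : ℕ) (v : E) :
    ∑ i : Fin N, ‖(inner ℂ (b i) v : ℂ)‖ ^ 2 ≤ ‖v‖ ^ 2 := by
  rw [Finset.sum_range (f := fun i => ‖(inner ℂ (b i) v : ℂ)‖ ^ 2) |>.symm]
  exact b.orthonormal.sum_inner_products_le v

/-- The determinants of the finite blocks of `1 + T`, with `T` of trace class, converge, and the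
limit is computed by the Gram type matrices of the vectors that represent `T`. -/
theorem exists_hasInfDet_gram (b : HilbertBasis ℕ ℂ E) (R : E →L[ℂ] E) (x y : ℕ → E) (α : ℕ → ℝ)
    (hα : Summable α) (hx : ∀ k, ‖x k‖ ^ 2 ≤ α k) (hy : ∀ k, ‖y k‖ ^ 2 ≤ α k)
    (hR : ∀ v, HasSum (fun k => (inner ℂ (x k) v : ℂ) • y k)
      ((R - ContinuousLinearMap.id ℂ E) v)) :
    ∃ L, HasInfDet (opMatrix b R) L ∧
      Tendsto (fun K => (1 + Matrix.of fun j k : Fin K => (inner ℂ (x j) (y k) : ℂ)).det)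
        atTop (𝓝 L) := by
  have hα0 : ∀ k, 0 ≤ α k := fun k => (sq_nonneg _).trans (hx k)
  let Y : ∀ N K : ℕ, Matrix (Fin N) (Fin K) ℂ := fun N K => Matrix.of fun i k => inner ℂ (b i) (y k)
  let X : ∀ N K : ℕ, Matrix (Fin K) (Fin N) ℂ := fun N K => Matrix.of fun k i => inner ℂ (x k) (b i)
  have hXn : ∀ N k, ∑ i : Fin N, ‖(inner ℂ (x k) (b i) : ℂ)‖ ^ 2 ≤ α k := by
    intro N k
    refine le_trans (le_of_eq ?_) ((sum_fin_norm_inner_sq_le b N (x k)).trans (hx k))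
    exact Finset.sum_congr rfl fun i _ => by rw [norm_inner_symm]
  have hYn : ∀ N k, ∑ i : Fin N, ‖(inner ℂ (b i) (y k) : ℂ)‖ ^ 2 ≤ α k := fun N k =>
    (sum_fin_norm_inner_sq_le b N (y k)).trans (hy k)
  -- $N$ is the size of the block and $K$ the number of rank one terms kept. The limit in $K$ gives
  -- the block determinant, the limit in $N$ the Gram type determinant.
  refine exists_tendsto_of_summable_increments (u := fun N K => (1 + Y N K * X N K).det)
    (β := fun K => 2 * Real.exp (2 * (∑' k, α k) + 2) * α K) (hα.mul_left _) ?_ ?_ ?_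
  · intro N K
    have h1 : 1 + Y N (K + 1) * X N (K + 1) = 1 + Y N K * X N K +
        Matrix.vecMulVec (fun i : Fin N => (inner ℂ (b i) (y K) : ℂ))
          (fun i : Fin N => (inner ℂ (x K) (b i) : ℂ)) := by
      ext i j
      simp only [Matrix.add_apply, Matrix.mul_apply, Fin.sum_univ_castSucc, Matrix.vecMulVec_apply,
        Y, X, Matrix.of_apply, Fin.val_castSucc, Fin.val_last]
      ring
    have hS : ∀ K, ∑ k : Fin K, α k ≤ ∑' k, α k := by
      intro K
      rw [← Finset.sum_range]
      exact hα.sum_le_tsum _ fun k _ => hα0 k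
    simp only [h1]
    have := norm_det_one_add_mul_add_vecMulVec_sub_le (Y N K) (X N K) (∑' k, α k)
      ((Finset.sum_le_sum fun (k : Fin K) _ => hYn N k).trans (hS K))
      ((Finset.sum_le_sum fun (k : Fin K) _ => hXn N k).trans (hS K))
      (fun i : Fin N => (inner ℂ (b i) (y K) : ℂ)) (fun i : Fin N => (inner ℂ (x K) (b i) : ℂ)) (√(α K)) (√(α K))
      (Real.sqrt_nonneg _) (Real.sqrt_nonneg _)
      (by rw [Real.sq_sqrt (hα0 K)]; exact hYn N K) (by rw [Real.sq_sqrt (hα0 K)]; exact hXn N K)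
    rwa [Real.mul_self_sqrt (hα0 K)] at this
  · intro N
    refine tendsto_det fun i j => ?_
    have h1 := ((hR (b j)).mapL (innerSL ℂ (b i))).tendsto_sum_nat
    simp only [topLeft, Matrix.submatrix_apply, opMatrix_eq, Matrix.add_apply, Matrix.mul_apply,
      Matrix.one_apply, Fin.ext_iff, Y, X, Matrix.of_apply]
    refine Tendsto.const_add _ ?_
    refine h1.congr fun K => ?_
    rw [Finset.sum_range]
    exact Finset.sum_congr rfl fun k _ => by
      rw [innerSL_apply_apply, inner_smul_right, mul_comm]
  · intro K
    -- Exchanging the factors leaves a matrix of fixed size $K$ whose entries converge by Parseval.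
    refine Tendsto.congr (fun N => Matrix.det_one_add_mul_comm (X N K) (Y N K)) ?_
    refine tendsto_det fun j k => ?_
    simp only [Matrix.add_apply, Matrix.mul_apply, Y, X, Matrix.of_apply]
    refine Tendsto.const_add _ ?_
    have h1 := (b.hasSum_inner_mul_inner (x j) (y k)).tendsto_sum_nat
    refine h1.congr fun N => ?_
    rw [Finset.sum_range]

/-- The determinant of `1 + T`, with `T` of trace class, exists and is invariant under
conjugation. -/
theorem exists_hasInfDet_conj [CompleteSpace E] (b : HilbertBasis ℕ ℂ E) {R : E →L[ℂ] E}
    (hR : IsTraceClass (R - ContinuousLinearMap.id ℂ E)) (A B : E →L[ℂ] E)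
    (hAB : A ∘L B = ContinuousLinearMap.id ℂ E) (hBA : B ∘L A = ContinuousLinearMap.id ℂ E) :
    ∃ L, HasInfDet (opMatrix b R) L ∧ HasInfDet (opMatrix b (A ∘L R ∘L B)) L := by
  obtain ⟨x, y, α, hα, hx, hy, hs⟩ := hR.exists_balanced
  obtain ⟨L, h1, h2⟩ := exists_hasInfDet_gram b R x y α hα hx hy hs
  have hα0 : ∀ k, 0 ≤ α k := fun k => (sq_nonneg _).trans (hx k)
  set B' := ContinuousLinearMap.adjoint B
  -- The conjugated perturbation is represented by $B^*x_k$ and $Ay_k$; the sum of the two squared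
  -- norms serves as a common factor in the majorant.
  obtain ⟨L', h1', h2'⟩ := exists_hasInfDet_gram b (A ∘L R ∘L B) (fun k => B' (x k))
    (fun k => A (y k)) (fun k => (‖A‖ ^ 2 + ‖B'‖ ^ 2) * α k) (hα.mul_left _)
    (fun k => by
      have := B'.le_opNorm (x k)
      calc ‖B' (x k)‖ ^ 2 ≤ (‖B'‖ * ‖x k‖) ^ 2 := by gcongr
        _ = ‖B'‖ ^ 2 * ‖x k‖ ^ 2 := by ring
        _ ≤ (‖A‖ ^ 2 + ‖B'‖ ^ 2) * α k := by
          have := hx k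
          have := hα0 k
          gcongr
          exact le_add_of_nonneg_left (by positivity))
    (fun k => by
      have := A.le_opNorm (y k)
      calc ‖A (y k)‖ ^ 2 ≤ (‖A‖ * ‖y k‖) ^ 2 := by gcongr
        _ = ‖A‖ ^ 2 * ‖y k‖ ^ 2 := by ring
        _ ≤ (‖A‖ ^ 2 + ‖B'‖ ^ 2) * α k := by
          have := hy k
          have := hα0 k
          gcongr
          exact le_add_of_nonneg_right (by positivity))
    (fun v => by
      have h3 := (hs (B v)).mapL A
      have h4 : A ((R - ContinuousLinearMap.id ℂ E) (B v)) =
          (A ∘L R ∘L B - ContinuousLinearMap.id ℂ E) v := by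
        have := congrArg (fun T : E →L[ℂ] E => T v) hAB
        simp only [ContinuousLinearMap.comp_apply, ContinuousLinearMap.id_apply] at this
        simp [this]
      rw [h4] at h3
      simpa [B', ContinuousLinearMap.adjoint_inner_left] using h3)
  -- Since $BA=1$, the Gram type matrices coincide, and therefore so do the two determinants.
  have h5 : ∀ j k, (inner ℂ (B' (x j)) (A (y k)) : ℂ) = inner ℂ (x j) (y k) := by
    intro j k
    have := congrArg (fun T : E →L[ℂ] E => T (y k)) hBA
    simp only [ContinuousLinearMap.comp_apply, ContinuousLinearMap.id_apply] at this
    rw [ContinuousLinearMap.adjoint_inner_left, this]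
  simp only [h5] at h2'
  rw [tendsto_nhds_unique h2' h2] at h1'
  exact ⟨L, h1, h1'⟩

theorem IsTraceClass.exists_hasInfDet [CompleteSpace E] (b : HilbertBasis ℕ ℂ E) {R : E →L[ℂ] E}
    (hR : IsTraceClass (R - ContinuousLinearMap.id ℂ E)) : ∃ L, HasInfDet (opMatrix b R) L := by
  obtain ⟨L, h, -⟩ := exists_hasInfDet_conj b hR (ContinuousLinearMap.id ℂ E)
    (ContinuousLinearMap.id ℂ E) rfl rfl
  exact ⟨L, h⟩

end Fredholm

/-! ### The Cauchy-Binet formula -/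

section CauchyBinet

variable {ι R : Type*} [Fintype ι] [CommRing R] {N : ℕ}

/-- Each row of $AB$ is a combination of rows of $B$; the determinant is multilinear in the rows. -/
theorem det_mul_eq_sum_functions (A : Matrix (Fin N) ι R) (B : Matrix ι (Fin N) R) :
    (A * B).det = ∑ f : Fin N → ι, (∏ i, A i (f i)) * (B.submatrix f id).det := by
  have h1 : A * B = fun i => ∑ j, A i j • B j := by
    ext i k
    simp [Matrix.mul_apply, Finset.sum_apply]
  rw [h1]
  change Matrix.detRowAlternating (fun i => ∑ j, A i j • B j) = _
  rw [← AlternatingMap.coe_multilinearMap, MultilinearMap.map_sum]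
  refine Finset.sum_congr rfl fun f _ => ?_
  rw [MultilinearMap.map_smul_univ, smul_eq_mul]
  rfl

/-- The Cauchy-Binet formula, with the subsets of size `N` listed in increasing order. -/
theorem det_mul_eq_sum_strictMono [LinearOrder ι] (A : Matrix (Fin N) ι R) (B : Matrix ι (Fin N) R) :
    (A * B).det = ∑ f : {f : Fin N → ι // StrictMono f},
      (A.submatrix id f.1).det * (B.submatrix f.1 id).det := by
  classical
  have h2 : ∀ f : {f : Fin N → ι // StrictMono f},
      (A.submatrix id f.1).det * (B.submatrix f.1 id).det =
      ∑ σ : Equiv.Perm (Fin N), (∏ i, A i (f.1 (σ i))) * (B.submatrix (f.1 ∘ σ) id).det := by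
    intro f
    rw [← Matrix.det_transpose (A.submatrix id f.1), Matrix.det_apply', Finset.sum_mul]
    refine Finset.sum_congr rfl fun σ _ => ?_
    have := Matrix.det_permute σ (B.submatrix f.1 id)
    rw [Matrix.submatrix_submatrix] at this
    simp only [Function.id_comp] at this
    rw [this]
    simp only [Matrix.transpose_apply, Matrix.submatrix_apply, id]
    ring
  rw [det_mul_eq_sum_functions, Finset.sum_congr rfl fun f _ => h2 f, ← Fintype.sum_prod_type']
  symm
  -- $(f,\sigma)\mapsto f\circ\sigma$ parametrises the injective functions, by sorting; the other
  -- functions repeat a row and contribute zero.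
  refine Finset.sum_of_injOn (fun p => p.1.1 ∘ p.2) ?_ (by simp) ?_ (fun p _ => rfl)
  · rintro ⟨f, σ⟩ - ⟨g, τ⟩ - h
    simp only at h
    have hr : Set.range f.1 = Set.range g.1 := by
      have := congrArg Set.range h
      rwa [EquivLike.range_comp, EquivLike.range_comp] at this
    have hfg : f = g := Subtype.ext ((StrictMono.range_inj f.2 g.2).1 hr)
    subst hfg
    refine Prod.ext rfl (Equiv.ext fun i => f.2.injective (congrFun h i))
  · intro f _ hf
    have hinj : ¬ Function.Injective f := by
      intro hi
      apply hf
      refine ⟨(⟨f ∘ Tuple.sort f, (Tuple.monotone_sort f).strictMono_of_injective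
        (hi.comp (Tuple.sort f).injective)⟩, (Tuple.sort f)⁻¹), by simp, ?_⟩
      ext i
      simp
    rw [Function.Injective] at hinj
    push Not at hinj
    obtain ⟨i, j, hij, hne⟩ := hinj
    rw [Matrix.det_zero_of_row_eq hne (by ext k; simp [hij]), mul_zero]

end CauchyBinet

/-! ### The finite sets that describe a point of the index set -/

namespace SSet

/-- The underlying sequence. -/
def seq (S : SSet) : ℕ → ℤ := S.1

theorem strictMono_seq (S : SSet) : StrictMono S.seq := S.2.1

theorem exists_stable (S : SSet) : ∃ N : ℕ, ∀ j, N ≤ j → S.seq j = (j : ℤ) := by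
  obtain ⟨N, hN⟩ := S.2.2
  exact ⟨N + 1, fun j hj => hN j (by omega)⟩

theorem ext_seq {S T : SSet} (h : S.seq = T.seq) : S = T := Subtype.ext h

theorem finite_neg (S : SSet) : {i : ℕ | ∃ j, S.seq j = -((i : ℤ) + 1)}.Finite := by
  obtain ⟨N, hN⟩ := S.exists_stable
  refine ((Finset.range N).image fun j => (-S.seq j - 1).toNat).finite_toSet.subset ?_
  rintro i ⟨j, hj⟩
  simp only [Finset.coe_image, Set.mem_image, Finset.mem_coe, Finset.mem_range]
  refine ⟨j, ?_, by omega⟩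
  by_contra hlt
  have := hN j (by omega)
  omega

theorem finite_gap (S : SSet) : {q : ℕ | ∀ j, S.seq j ≠ (q : ℤ)}.Finite := by
  obtain ⟨N, hN⟩ := S.exists_stable
  refine (Finset.range N).finite_toSet.subset fun q hq => ?_
  simp only [Finset.mem_coe, Finset.mem_range]
  by_contra hlt
  exact hq q (hN q (by omega))

/-- The `i` such that `-(i + 1)` occurs in the sequence. -/
def neg (S : SSet) : Finset ℕ := S.finite_neg.toFinset

/-- The natural numbers that do not occur in the sequence. -/
def gap (S : SSet) : Finset ℕ := S.finite_gap.toFinset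

theorem mem_neg {S : SSet} {i : ℕ} : i ∈ S.neg ↔ ∃ j, S.seq j = -((i : ℤ) + 1) := by simp [neg]

theorem mem_gap {S : SSet} {q : ℕ} : q ∈ S.gap ↔ ∀ j, S.seq j ≠ (q : ℤ) := by simp [gap]

/-- The two finite sets recover the range of the sequence, and a strictly increasing sequence is
determined by its range. -/
theorem injective_neg_gap : Function.Injective fun S : SSet => (S.neg, S.gap) := by
  intro S T h
  have h1 : S.neg = T.neg := congrArg Prod.fst h
  have h2 : S.gap = T.gap := congrArg Prod.snd h
  refine ext_seq ((StrictMono.range_inj S.strictMono_seq T.strictMono_seq).1 ?_)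
  ext z
  rcases lt_or_ge z 0 with hz | hz
  · have h3 := Finset.ext_iff.1 h1 (-z - 1).toNat
    rw [mem_neg, mem_neg, show -(((-z - 1).toNat : ℤ) + 1) = z by omega] at h3
    exact h3
  · have h3 := Finset.ext_iff.1 h2 z.toNat
    rw [mem_gap, mem_gap, show ((z.toNat : ℤ)) = z by omega] at h3
    simp only [Set.mem_range]
    rw [← not_iff_not]
    push Not
    exact h3

theorem lt_of_stable {S : SSet} {N : ℕ} (hN : ∀ j, N ≤ j → S.seq j = (j : ℤ)) (m : Fin N) :
    S.seq m < N := by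
  have := S.strictMono_seq m.2
  rwa [hN N le_rfl] at this

/-- All negative terms occur among the first $N$, each once. This converts row or column bounds of
an $N\times N$ minor into a product independent of $N$. -/
theorem prod_neg {S : SSet} {N : ℕ} (hN : ∀ j, N ≤ j → S.seq j = (j : ℤ)) (f : ℕ → ℝ) :
    ∏ m : Fin N, (if 0 ≤ S.seq m then 1 else f (-S.seq m - 1).toNat) = ∏ i ∈ S.neg, f i := by
  classical
  have h1 : S.neg = (Finset.univ.filter fun m : Fin N => ¬ 0 ≤ S.seq m).image
      fun m : Fin N => (-S.seq m - 1).toNat := by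
    ext i
    simp only [mem_neg, Finset.mem_image, Finset.mem_filter, Finset.mem_univ, true_and]
    constructor
    · rintro ⟨j, hj⟩
      have hjN : j < N := by
        by_contra h
        have := hN j (by omega)
        omega
      exact ⟨⟨j, hjN⟩, by simp only [hj]; omega, by simp only [hj]; omega⟩
    · rintro ⟨m, hm, rfl⟩
      exact ⟨m, by omega⟩
  rw [h1, Finset.prod_image, Finset.prod_filter]
  · exact Finset.prod_congr rfl fun m _ => by split_ifs <;> rfl
  · intro a ha b hb hab
    simp only [Finset.coe_filter, Finset.mem_univ, true_and, Set.mem_ofPred_eq] at ha hb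
    exact Fin.ext (S.strictMono_seq.injective (by simp only at hab; omega))

/-- $\{0,\dots,N-1\}$ is the disjoint union of the gaps and of the nonnegative terms among the first
$N$. -/
theorem prod_gap {S : SSet} {N : ℕ} (hN : ∀ j, N ≤ j → S.seq j = (j : ℤ)) (f : ℕ → ℝ) :
    (∏ q ∈ S.gap, f q) * ∏ m : Fin N, (if 0 ≤ S.seq m then f (S.seq m).toNat else 1) =
      ∏ l : Fin N, f l := by
  classical
  set I := (Finset.univ.filter fun m : Fin N => 0 ≤ S.seq m).image fun m : Fin N => (S.seq m).toNat with hI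
  have h1 : ∏ m : Fin N, (if 0 ≤ S.seq m then f (S.seq m).toNat else 1) = ∏ q ∈ I, f q := by
    rw [hI, Finset.prod_image, Finset.prod_filter]
    intro a ha b hb hab
    simp only [Finset.coe_filter, Finset.mem_univ, true_and, Set.mem_ofPred_eq] at ha hb
    exact Fin.ext (S.strictMono_seq.injective (by simp only at hab; omega))
  have hmem : ∀ q, q ∈ I ↔ q < N ∧ q ∉ S.gap := by
    intro q
    simp only [hI, mem_gap, Finset.mem_image, Finset.mem_filter, Finset.mem_univ, true_and]
    push Not
    constructor
    · rintro ⟨m, hm, rfl⟩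
      have := lt_of_stable hN m
      exact ⟨by omega, m, by omega⟩
    · rintro ⟨hq, j, hj⟩
      have hjN : j < N := by
        by_contra h
        have := hN j (by omega)
        omega
      exact ⟨⟨j, hjN⟩, by simp only [hj]; omega, by simp only [hj]; omega⟩
  have hgap : ∀ q ∈ S.gap, q < N := by
    intro q hq
    by_contra h
    exact mem_gap.1 hq q (hN q (by omega))
  have h2 : Finset.range N = S.gap ∪ I := by
    ext q
    simp only [Finset.mem_range, Finset.mem_union, hmem]
    constructor
    · intro h
      by_cases h' : q ∈ S.gap
      · exact Or.inl h'
      · exact Or.inr ⟨h, h'⟩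
    · rintro (h | h)
      · exact hgap q h
      · exact h.1
  rw [h1, ← Finset.prod_range, h2, Finset.prod_union]
  rw [Finset.disjoint_left]
  intro q hq hq'
  exact ((hmem q).1 hq').2 hq

/-- The index set embeds into pairs of finite sets, over which the sum is dominated by expanding
$\prod(1+\gamma_i)\prod(1+\omega_q)$. This is the source of unconditional convergence. -/
theorem summable_prod_neg_gap {γ ω : ℕ → ℝ} (hγ0 : ∀ i, 0 ≤ γ i) (hω0 : ∀ i, 0 ≤ ω i)
    (hγ : Summable γ) (hω : Summable ω) :
    Summable fun S : SSet => (∏ i ∈ S.neg, γ i) * ∏ q ∈ S.gap, ω q := by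
  have h : Summable fun p : Finset ℕ × Finset ℕ => (∏ i ∈ p.1, γ i) * ∏ q ∈ p.2, ω q :=
    (summable_finsetProd_of_summable_nonneg hγ0 hγ).mul_of_nonneg
    (summable_finsetProd_of_summable_nonneg hω0 hω)
    (fun _ => Finset.prod_nonneg fun i _ => hγ0 i) (fun _ => Finset.prod_nonneg fun i _ => hω0 i)
  exact h.comp_injective (i := fun S : SSet => (S.neg, S.gap)) injective_neg_gap

/-- The point of the index set that begins with a given finite sequence. -/
def ofFin {N : ℕ} (f : Fin N → ℤ) (hf : StrictMono f) (hN : ∀ i, f i < N) : SSet :=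
  ⟨fun j => if h : j < N then f ⟨j, h⟩ else j, by
    constructor
    · intro i j hij
      change (if h : i < N then f ⟨i, h⟩ else (i : ℤ)) < if h : j < N then f ⟨j, h⟩ else (j : ℤ)
      by_cases hj : j < N
      · rw [dif_pos hj, dif_pos (hij.trans hj)]
        exact hf hij
      · rw [dif_neg hj]
        by_cases hi : i < N
        · rw [dif_pos hi]
          have := hN ⟨i, hi⟩
          omega
        · rw [dif_neg hi]
          omega
    · exact ⟨N, fun j hj => dif_neg (by omega)⟩⟩

theorem ofFin_apply {N : ℕ} (f : Fin N → ℤ) (hf : StrictMono f) (hN : ∀ i, f i < N) (m : Fin N) :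
    (ofFin f hf hN).seq m = f m := dif_pos m.2

theorem ofFin_apply_of_le {N : ℕ} (f : Fin N → ℤ) (hf : StrictMono f) (hN : ∀ i, f i < N) (j : ℕ)
    (hj : N ≤ j) : (ofFin f hf hN).seq j = j := dif_neg (by omega)

end SSet

open Classical in
/-- The Cauchy-Binet formula as a sum over the index set. -/
theorem det_sum_Ico_eq_tsum (A : ℕ → ℤ → ℂ) (w : ℤ → ℕ → ℂ) (N M : ℕ) :
    (Matrix.of fun l m : Fin N => ∑ s ∈ Finset.Ico (-(M : ℤ)) N, A l s * w s m).det =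
      ∑' S : SSet, if (∀ j, N ≤ j → S.seq j = (j : ℤ)) ∧ ∀ j, -(M : ℤ) ≤ S.seq j then
        (Matrix.of fun l m : Fin N => A l (S.seq m)).det *
        (Matrix.of fun l m : Fin N => w (S.seq l) m).det else 0 := by
  let ι := {s : ℤ // s ∈ Finset.Ico (-(M : ℤ)) N}
  let A' : Matrix (Fin N) ι ℂ := Matrix.of fun l s => A l s.1
  let w' : Matrix ι (Fin N) ℂ := Matrix.of fun s m => w s.1 m
  have h1 : (Matrix.of fun l m : Fin N => ∑ s ∈ Finset.Ico (-(M : ℤ)) N, A l s * w s m) =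
      A' * w' := by
    ext l m
    simp only [Matrix.of_apply, Matrix.mul_apply, A', w']
    exact (Finset.sum_coe_sort (Finset.Ico (-(M : ℤ)) N) fun s => A l s * w s m).symm
  rw [h1, det_mul_eq_sum_strictMono]
  have hlt : ∀ (f : Fin N → ι) i, ((f i).1 : ℤ) < N := fun f i => (Finset.mem_Ico.1 (f i).2).2
  -- Extending by $s_j=j$ for $j\ge N$ is increasing because all values are below $N$; the image
  -- consists of the $S$ in the `if` condition.
  let φ : {f : Fin N → ι // StrictMono f} → SSet := fun f =>
    SSet.ofFin (fun i => (f.1 i).1) (fun i j hij => f.2 hij) (hlt f.1)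
  have hφv : ∀ f (m : Fin N), (φ f).seq m = (f.1 m).1 := fun f m => SSet.ofFin_apply _ _ _ m
  have hφ : Function.Injective φ := by
    intro f g h
    refine Subtype.ext (funext fun i => Subtype.ext ?_)
    have h3 : (φ f).seq i = (φ g).seq i := by rw [h]
    exact (hφv f i).symm.trans (h3.trans (hφv g i))
  rw [← hφ.tsum_eq, tsum_fintype]
  · refine Finset.sum_congr rfl fun f _ => ?_
    rw [if_pos]
    · congr 2
      · ext l m
        simp only [A', Matrix.submatrix_apply, Matrix.of_apply, hφv, id]
      · ext l m
        simp only [w', Matrix.submatrix_apply, Matrix.of_apply, hφv, id]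
    · refine ⟨fun j hj => SSet.ofFin_apply_of_le _ _ _ j hj, fun j => ?_⟩
      rcases lt_or_ge j N with hj | hj
      · exact (hφv f ⟨j, hj⟩).symm ▸ (Finset.mem_Ico.1 (f.1 ⟨j, hj⟩).2).1
      · have : (φ f).seq j = j := SSet.ofFin_apply_of_le _ _ _ j hj
        omega
  · intro S hS
    rw [Function.mem_support, ne_eq, ite_eq_right_iff, Classical.not_imp] at hS
    obtain ⟨⟨hS1, hS2⟩, -⟩ := hS
    refine ⟨⟨fun i => ⟨S.seq i, Finset.mem_Ico.2 ⟨hS2 i, SSet.lt_of_stable hS1 i⟩⟩,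
      fun i j hij => S.strictMono_seq hij⟩, ?_⟩
    refine SSet.ext_seq (funext fun j => ?_)
    rcases lt_or_ge j N with hj | hj
    · exact SSet.ofFin_apply _ _ _ ⟨j, hj⟩
    · rw [hS1 j hj]
      exact SSet.ofFin_apply_of_le _ _ _ j hj

/-! ### Bounds for the minors -/

/-- The minors of `[1 | c]`, with `c` decaying in both indices. -/
theorem norm_det_columns_le (A : ℕ → ℤ → ℂ) (ω β : ℕ → ℝ) (Ω : ℝ) (hω : ∀ l, 0 < ω l)
    (hβ : ∀ i, 0 ≤ β i) (hΩ : 0 ≤ Ω) (hωΩ : ∀ N : ℕ, ∑ l : Fin N, ω l ^ 2 ≤ Ω ^ 2)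
    (hA0 : ∀ l s : ℕ, A l s = if l = s then 1 else 0)
    (hA : ∀ l i : ℕ, ‖A l (-((i : ℤ) + 1))‖ ≤ ω l ^ 2 * β i)
    (S : SSet) (N : ℕ) (hN : ∀ j, N ≤ j → S.seq j = (j : ℤ)) :
    ‖(Matrix.of fun l m : Fin N => A l (S.seq m)).det‖ ≤
      (∏ i ∈ S.neg, Ω * β i) * ∏ q ∈ S.gap, ω q := by
  -- Row $l$ is divided by $\omega_l$ and column $m$ multiplied by $\kappa_m$. Identity columns stay
  -- unit vectors, and a negative column keeps entries of size at most $\omega_l\beta_i$, hence norm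
  -- at most $\Omega\beta_i$; this is why the decay hypothesis has $\omega_l^2$. The scaling costs
  -- $\prod\omega_l/\prod\kappa_m$, the product of $\omega$ over the gaps.
  set κ : Fin N → ℝ := fun m => if 0 ≤ S.seq m then ω (S.seq m).toNat else 1 with hκ
  have hκ0 : ∀ m, 0 < κ m := by
    intro m
    simp only [hκ]
    split_ifs
    · exact hω _
    · exact one_pos
  set A' : Matrix (Fin N) (Fin N) ℂ := Matrix.of fun l m =>
    ((ω l : ℝ) : ℂ)⁻¹ * ((κ m : ℂ) * A l (S.seq m)) with hA'
  have h1 : (Matrix.of fun l m : Fin N => A l (S.seq m)) =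
      Matrix.of fun l m : Fin N => ((ω l : ℝ) : ℂ) *
        (Matrix.of fun l m : Fin N => ((κ m : ℝ) : ℂ)⁻¹ * A' l m) l m := by
    ext l m
    have e1 : ((ω l : ℝ) : ℂ) ≠ 0 := by exact_mod_cast (hω l).ne'
    have e2 : ((κ m : ℝ) : ℂ) ≠ 0 := by exact_mod_cast (hκ0 m).ne'
    simp only [Matrix.of_apply, hA']
    field_simp
  have h2 : ‖A'.det‖ ≤ ∏ i ∈ S.neg, Ω * β i := by
    rw [← Matrix.det_transpose]
    refine (norm_det_le_prod_rows _).trans ?_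
    rw [← SSet.prod_neg hN]
    refine Finset.prod_le_prod (fun _ _ => Real.sqrt_nonneg _) fun m _ => ?_
    simp only [Matrix.transpose_apply, hA', Matrix.of_apply]
    split_ifs with hm
    · rw [Real.sqrt_le_left zero_le_one, one_pow]
      obtain ⟨s, hs⟩ := Int.eq_ofNat_of_zero_le hm
      have hsN : s < N := by
        have := SSet.lt_of_stable hN m
        omega
      have h3 : ∀ l : Fin N, ‖((ω l : ℝ) : ℂ)⁻¹ * ((κ m : ℂ) * A l (S.seq m))‖ ^ 2 =
          if l = ⟨s, hsN⟩ then 1 else 0 := by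
        intro l
        rw [hs, hA0]
        by_cases hl : (l : ℕ) = s
        · rw [if_pos hl, if_pos (Fin.ext hl), mul_one]
          have e1 : ((ω s : ℝ) : ℂ) ≠ 0 := by exact_mod_cast (hω s).ne'
          have e2 : κ m = ω s := by simp [hκ, hs]
          rw [e2, hl, inv_mul_cancel₀ e1]
          simp
        · rw [if_neg hl, if_neg (fun h => hl (congrArg Fin.val h))]
          simp
      simp only [h3]
      simp
    · set i := (-S.seq m - 1).toNat with hi
      have hs : S.seq m = -((i : ℤ) + 1) := by omega
      rw [Real.sqrt_le_left (mul_nonneg hΩ (hβ i)), mul_pow]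
      refine le_trans (Finset.sum_le_sum (g := fun l : Fin N => ω l ^ 2 * β i ^ 2) fun l _ => ?_) ?_
      · have e2 : κ m = 1 := by simp only [hκ]; rw [if_neg hm]
        rw [e2, Complex.ofReal_one, one_mul, hs, norm_mul, norm_inv, Complex.norm_real,
          Real.norm_of_nonneg (hω l).le, ← mul_pow]
        refine pow_le_pow_left₀ (mul_nonneg (inv_nonneg.2 (hω l).le) (norm_nonneg _)) ?_ 2
        rw [inv_mul_le_iff₀ (hω l)]
        calc _ ≤ ω l ^ 2 * β i := hA l i
          _ = _ := by ring
      · rw [← Finset.sum_mul]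
        exact mul_le_mul_of_nonneg_right (hωΩ N) (sq_nonneg _)
  have h3 : ‖∏ m, ((κ m : ℝ) : ℂ)⁻¹‖ = (∏ m, κ m)⁻¹ := by
    rw [norm_prod, ← Finset.prod_inv_distrib]
    exact Finset.prod_congr rfl fun m _ => by
      rw [norm_inv, Complex.norm_real, Real.norm_of_nonneg (hκ0 m).le]
  have h4 : ‖∏ l : Fin N, ((ω l : ℝ) : ℂ)‖ = ∏ l : Fin N, ω l := by
    rw [norm_prod]
    exact Finset.prod_congr rfl fun m _ => by
      rw [Complex.norm_real, Real.norm_of_nonneg (hω m).le]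
  rw [h1, Matrix.det_mul_column, Matrix.det_mul_row, norm_mul, norm_mul, h3, h4,
    ← SSet.prod_gap hN ω]
  have h5 : (0 : ℝ) < ∏ m, κ m := Finset.prod_pos fun m _ => hκ0 m
  calc _ = (∏ q ∈ S.gap, ω q) * ‖A'.det‖ := by
        change (∏ q ∈ S.gap, ω q) * (∏ m, κ m) * ((∏ m, κ m)⁻¹ * ‖A'.det‖) = _
        field_simp
    _ ≤ _ := by
        rw [mul_comm]
        exact mul_le_mul_of_nonneg_right h2 (Finset.prod_nonneg fun q _ => (hω q).le)

/-- The minors of `[1 + T; w_-]`, with `T` of trace class and `w_-` bounded. -/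
theorem norm_det_rows_le (w : ℤ → ℕ → ℂ) (Y X : ℕ → ℕ → ℂ) (α : ℕ → ℝ) (C : ℝ) (hC : 1 ≤ C)
    (hw : ∀ (s : ℤ) (N : ℕ), ∑ m : Fin N, ‖w s m‖ ^ 2 ≤ C ^ 2) (hα : Summable α)
    (hY : ∀ (k : ℕ) (I : Finset ℕ), ∑ l ∈ I, ‖Y l k‖ ^ 2 ≤ α k)
    (hX : ∀ k N : ℕ, ∑ m : Fin N, ‖X k m‖ ^ 2 ≤ α k)
    (hT : ∀ l m : ℕ, HasSum (fun k => Y l k * X k m) (w l m - if l = m then 1 else 0))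
    (S : SSet) (N : ℕ) (hN : ∀ j, N ≤ j → S.seq j = (j : ℤ)) :
    ‖(Matrix.of fun l m : Fin N => w (S.seq l) m).det‖ ≤
      (∏ _i ∈ S.neg, C) * Real.exp (2 * ∑' k, α k) := by
  classical
  have hα0 : ∀ k, 0 ≤ α k := fun k => by simpa using hY k ∅
  -- The minor is $B+Y'X'$ in the limit $K\to\infty$. $B$ has unit vectors in the nonnegative rows
  -- and the rows of $w_-$ elsewhere; the trace class part enters only the nonnegative rows.
  let B : Matrix (Fin N) (Fin N) ℂ := Matrix.of fun l m =>
    if 0 ≤ S.seq l then (if (S.seq l).toNat = m then 1 else 0) else w (S.seq l) m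
  let Y' : ∀ K : ℕ, Matrix (Fin N) (Fin K) ℂ := fun K => Matrix.of fun l k =>
    if 0 ≤ S.seq l then Y (S.seq l).toNat k else 0
  let X' : ∀ K : ℕ, Matrix (Fin K) (Fin N) ℂ := fun K => Matrix.of fun k m => X k m
  have hS : ∀ K, ∑ k : Fin K, α k ≤ ∑' k, α k := by
    intro K
    rw [← Finset.sum_range]
    exact hα.sum_le_tsum _ fun k _ => hα0 k
  have hlim : Tendsto (fun K => (B + Y' K * X' K).det) atTop
      (𝓝 (Matrix.of fun l m : Fin N => w (S.seq l) m).det) := by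
    refine tendsto_det fun l m => ?_
    simp only [Matrix.add_apply, Matrix.mul_apply, B, Y', X', Matrix.of_apply]
    by_cases hl : 0 ≤ S.seq l
    · simp only [if_pos hl]
      have h1 := ((hT (S.seq l).toNat m).tendsto_sum_nat).const_add
        (if (S.seq l).toNat = (m : ℕ) then (1 : ℂ) else 0)
      rw [add_sub_cancel, Int.toNat_of_nonneg hl] at h1
      exact h1.congr fun K => by rw [Finset.sum_range]
    · simp only [if_neg hl, zero_mul, Finset.sum_const_zero, add_zero]
      exact tendsto_const_nhds
  refine le_of_tendsto hlim.norm (Eventually.of_forall fun K => ?_)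
  have hYK : ∀ k : ℕ, ∑ l : Fin N, ‖(if 0 ≤ S.seq l then Y (S.seq l).toNat k else 0)‖ ^ 2 ≤ α k := by
    intro k
    have h1 : ∑ l : Fin N, ‖(if 0 ≤ S.seq l then Y (S.seq l).toNat k else 0)‖ ^ 2 =
        ∑ q ∈ (Finset.univ.filter fun l : Fin N => 0 ≤ S.seq l).image
          (fun l : Fin N => (S.seq l).toNat), ‖Y q k‖ ^ 2 := by
      rw [Finset.sum_image, Finset.sum_filter]
      · exact Finset.sum_congr rfl fun l _ => by split_ifs <;> simp
      · intro a ha b hb hab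
        simp only [Finset.coe_filter, Finset.mem_univ, true_and, Set.mem_ofPred_eq] at ha hb
        exact Fin.ext (S.strictMono_seq.injective (by simp only at hab; omega))
    rw [h1]
    exact hY k _
  refine (norm_det_add_mul_le B (Y' K) (X' K) (fun l => if 0 ≤ S.seq l then 1 else C)
    (fun l => by split_ifs; exacts [le_rfl, hC]) fun l => ?_).trans ?_
  · simp only [B, Matrix.of_apply]
    by_cases hl : 0 ≤ S.seq l
    · simp only [if_pos hl]
      have h2 : ∀ m : Fin N, ‖(if (S.seq l).toNat = (m : ℕ) then (1 : ℂ) else 0)‖ ^ 2 =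
          if m = ⟨(S.seq l).toNat, by have := SSet.lt_of_stable hN l; omega⟩ then 1 else 0 := by
        intro m
        by_cases hm : (S.seq l).toNat = (m : ℕ)
        · rw [if_pos hm, if_pos (Fin.ext hm.symm)]
          simp
        · rw [if_neg hm, if_neg fun h => hm (congrArg Fin.val h).symm]
          simp
      simp only [h2]
      simp
    · simp only [if_neg hl]
      exact hw _ N
  · rw [SSet.prod_neg hN fun _ => C]
    refine mul_le_mul_of_nonneg_left (Real.exp_le_exp.2 ?_)
      (Finset.prod_nonneg fun _ _ => zero_le_one.trans hC)
    rw [Finset.sum_comm]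
    have h3 := (Finset.sum_le_sum fun (k : Fin K) _ => hYK k).trans (hS K)
    have h4 := (Finset.sum_le_sum fun (k : Fin K) _ => hX k N).trans (hS K)
    simp only [Y', X', Matrix.of_apply]
    linarith

/-! ### The infinite Cauchy-Binet formula -/

open Classical in
/-- The Cauchy-Binet formula for infinite matrices: the determinant of the product of
`[1 | c]` and `[1 + T; w_-]`, with `T` of trace class, `w_-` bounded and `c` rapidly decaying. -/
theorem hasSum_infinite_cauchyBinet (A : ℕ → ℤ → ℂ) (w : ℤ → ℕ → ℂ) (v : ℕ → ℕ → ℂ)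
    (ω β : ℕ → ℝ) (hω : ∀ l, 0 < ω l) (hβ : ∀ i, 0 ≤ β i) (hωs : Summable ω) (hβs : Summable β)
    (hA0 : ∀ l s : ℕ, A l s = if l = s then 1 else 0)
    (hA : ∀ l i : ℕ, ‖A l (-((i : ℤ) + 1))‖ ≤ ω l ^ 2 * β i)
    (Y X : ℕ → ℕ → ℂ) (α : ℕ → ℝ) (C : ℝ) (hC : 1 ≤ C)
    (hw : ∀ (s : ℤ) (N : ℕ), ∑ m : Fin N, ‖w s m‖ ^ 2 ≤ C ^ 2) (hα : Summable α)
    (hY : ∀ (k : ℕ) (I : Finset ℕ), ∑ l ∈ I, ‖Y l k‖ ^ 2 ≤ α k)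
    (hX : ∀ k N : ℕ, ∑ m : Fin N, ‖X k m‖ ^ 2 ≤ α k)
    (hT : ∀ l m : ℕ, HasSum (fun k => Y l k * X k m) (w l m - if l = m then 1 else 0))
    (hv : ∀ l m : ℕ, HasSum (fun i : ℕ => A l (-((i : ℤ) + 1)) * w (-((i : ℤ) + 1)) m)
      (v l m - w l m))
    (p f : SSet → ℂ) (L : ℂ)
    (hp : ∀ S : SSet, HasInfDet (Matrix.of fun l m => w (S.seq l) m) (p S))
    (hf : ∀ S : SSet, HasInfDet (Matrix.of fun l m => A l (S.seq m)) (f S))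
    (hL : HasInfDet (Matrix.of v) L) :
    HasSum (fun S => p S * f S) L := by
  have hω2 : Summable fun l => ω l ^ 2 := by
    refine Summable.of_nonneg_of_le (fun _ => sq_nonneg _) (fun l => ?_) (hωs.mul_left (∑' l, ω l))
    rw [sq]
    exact mul_le_mul_of_nonneg_right (hωs.le_tsum l fun j _ => (hω j).le) (hω l).le
  set Ω : ℝ := √(∑' l, ω l ^ 2)
  have hΩ : ∀ N : ℕ, ∑ l : Fin N, ω l ^ 2 ≤ Ω ^ 2 := by
    intro N
    rw [Real.sq_sqrt (tsum_nonneg fun _ => sq_nonneg _), ← Finset.sum_range fun l => ω l ^ 2]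
    exact hω2.sum_le_tsum _ fun _ _ => sq_nonneg _
  set D : ℝ := Real.exp (2 * ∑' k, α k)
  -- Product of the bounds for the two minors. It does not involve $N$, so it dominates both limits
  -- below.
  set bound : SSet → ℝ := fun S => D * ((∏ i ∈ S.neg, C * (Ω * β i)) * ∏ q ∈ S.gap, ω q)
  have hbound : Summable bound := by
    refine (SSet.summable_prod_neg_gap (fun i => ?_) (fun q => (hω q).le) ?_ hωs).mul_left D
    · exact mul_nonneg (zero_le_one.trans hC) (mul_nonneg (Real.sqrt_nonneg _) (hβ i))
    · exact (hβs.mul_left Ω).mul_left C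
  let term : ℕ → SSet → ℂ := fun N S => (Matrix.of fun l m : Fin N => A l (S.seq m)).det *
    (Matrix.of fun l m : Fin N => w (S.seq l) m).det
  have hterm : ∀ (N : ℕ) S, (∀ j, N ≤ j → S.seq j = (j : ℤ)) → ‖term N S‖ ≤ bound S := by
    intro N S hN
    have h1 := norm_det_columns_le A ω β Ω hω hβ (Real.sqrt_nonneg _) hΩ hA0 hA S N hN
    have h2 := norm_det_rows_le w Y X α C hC hw hα hY hX hT S N hN
    calc ‖term N S‖ ≤ ((∏ i ∈ S.neg, Ω * β i) * ∏ q ∈ S.gap, ω q) *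
          ((∏ _i ∈ S.neg, C) * D) := by
          rw [norm_mul]
          exact mul_le_mul h1 h2 (norm_nonneg _) ((norm_nonneg _).trans h1)
      _ = bound S := by
          simp only [bound, Finset.prod_mul_distrib]
          ring
  have hbound0 : ∀ S, 0 ≤ bound S := by
    intro S
    obtain ⟨N, hN⟩ := S.exists_stable
    exact (norm_nonneg _).trans (hterm N S hN)
  -- For rows $l<N$ the columns $s\ge N$ of $A$ vanish, so only sequences stable from $N$ on
  -- contribute. The negative indices are cut off at $-M$ and $M\to\infty$.
  have hdet : ∀ N : ℕ, (topLeft (Matrix.of v) N).det =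
      ∑' S : SSet, if ∀ j, N ≤ j → S.seq j = (j : ℤ) then term N S else 0 := by
    intro N
    have h1 : Tendsto (fun M : ℕ => (Matrix.of fun l m : Fin N =>
        ∑ s ∈ Finset.Ico (-(M : ℤ)) N, A l s * w s m).det) atTop
        (𝓝 (topLeft (Matrix.of v) N).det) := by
      refine tendsto_det fun l m => ?_
      have h2 : ∀ M : ℕ, ∑ s ∈ Finset.Ico (-(M : ℤ)) N, A l s * w s m =
          w l m + ∑ i ∈ Finset.range M, A l (-((i : ℤ) + 1)) * w (-((i : ℤ) + 1)) m := by
        intro M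
        induction M with
        | zero =>
          have h3 : Finset.Ico (-((0 : ℕ) : ℤ)) (N : ℤ) =
              (Finset.range N).image (fun j : ℕ => (j : ℤ)) := by
            ext s
            simp only [Finset.mem_Ico, Finset.mem_image, Finset.mem_range]
            constructor
            · intro h
              exact ⟨s.toNat, by omega, by omega⟩
            · rintro ⟨j, hj, rfl⟩
              omega
          rw [h3, Finset.sum_image (fun a _ b _ h => by exact_mod_cast h), Finset.sum_range_zero,
            add_zero, Finset.sum_eq_single (l : ℕ)]
          · rw [hA0, if_pos rfl, one_mul]
          · intro j _ hj
            rw [hA0, if_neg (Ne.symm hj), zero_mul]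
          · intro h
            exact absurd (Finset.mem_range.2 l.2) h
        | succ M ih =>
          have h3 : Finset.Ico (-((M + 1 : ℕ) : ℤ)) (N : ℤ) =
              insert (-((M : ℤ) + 1)) (Finset.Ico (-(M : ℤ)) N) := by
            ext s
            simp only [Finset.mem_Ico, Finset.mem_insert]
            omega
          rw [h3, Finset.sum_insert (by simp), ih, Finset.sum_range_succ]
          ring
      simp only [Matrix.of_apply, h2, topLeft, Matrix.submatrix_apply]
      have := ((hv l m).tendsto_sum_nat).const_add (w l m)
      rwa [add_sub_cancel] at this
    refine tendsto_nhds_unique h1 ?_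
    simp only [det_sum_Ico_eq_tsum]
    refine tendsto_tsum_of_dominated_convergence hbound (fun S => ?_)
      (Eventually.of_forall fun M S => ?_)
    · refine tendsto_const_nhds.congr' ?_
      -- The smallest term is $s_0$, so the cutoff at $-M$ is eventually inactive for each $S$.
      filter_upwards [eventually_ge_atTop (-S.seq 0).toNat] with M hM
      have h4 : ∀ j, -(M : ℤ) ≤ S.seq j := by
        intro j
        have := S.strictMono_seq.monotone (Nat.zero_le j)
        omega
      by_cases h5 : ∀ j, N ≤ j → S.seq j = (j : ℤ)
      · rw [if_pos h5, if_pos ⟨h5, h4⟩]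
      · rw [if_neg h5, if_neg fun h => h5 h.1]
    · split_ifs with h
      · exact hterm N S h.1
      · simpa using hbound0 S
  have hlim : ∀ S, Tendsto (fun N : ℕ => if ∀ j, N ≤ j → S.seq j = (j : ℤ) then term N S else 0) atTop
      (𝓝 (p S * f S)) := by
    intro S
    obtain ⟨N₀, hN₀⟩ := S.exists_stable
    rw [mul_comm]
    refine ((hf S).mul (hp S)).congr' ?_
    filter_upwards [eventually_ge_atTop N₀] with N hN
    rw [if_pos fun j hj => hN₀ j (hN.trans hj)]
    rfl
  have hle : ∀ (N : ℕ) S, ‖if ∀ j, N ≤ j → S.seq j = (j : ℤ) then term N S else 0‖ ≤ bound S := by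
    intro N S
    split_ifs with h
    · exact hterm N S h
    · simpa using hbound0 S
  have hfinal := tendsto_tsum_of_dominated_convergence (𝓕 := atTop) hbound hlim
    (Eventually.of_forall hle)
  simp only [← hdet] at hfinal
  have hsum : Summable fun S => p S * f S := Summable.of_norm_bounded hbound fun S =>
    le_of_tendsto (hlim S).norm (Eventually.of_forall fun N => hle N S)
  rw [tendsto_nhds_unique hL hfinal]
  exact hsum.hasSum

/-! ### The orthonormal basis of the Hilbert space -/

theorem integral_fourier (m : ℤ) :
    ∫ t : Torus, fourier m t ∂AddCircle.haarAddCircle = if m = 0 then 1 else 0 := by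
  have h := orthonormal_iff_ite.1 (orthonormal_fourier (T := (1 : ℝ))) 0 m
  rw [L2.inner_def] at h
  have h2 : ∫ t : Torus, (inner ℂ ((fourierLp 2 0 : Lp ℂ 2 AddCircle.haarAddCircle) t)
      ((fourierLp 2 m : Lp ℂ 2 AddCircle.haarAddCircle) t) : ℂ) ∂AddCircle.haarAddCircle =
      ∫ t : Torus, fourier m t ∂AddCircle.haarAddCircle := by
    refine integral_congr_ae ?_
    filter_upwards [coeFn_fourierLp (T := (1 : ℝ)) 2 0, coeFn_fourierLp (T := (1 : ℝ)) 2 m]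
      with t h0 hm
    rw [h0, hm]
    simp
  rw [← h2, h]
  simp [eq_comm]

section Basis

variable (n : ℕ) [NeZero n]

theorem natCast_pos' : (0 : ℤ) < n := by exact_mod_cast Nat.pos_of_ne_zero (NeZero.ne n)

theorem div_add_res (k : ℤ) (r : Fin n) : (n * k + (r : ℕ) : ℤ) / n = k := by
  rw [add_comm, Int.add_mul_ediv_left _ _ (natCast_pos' n).ne',
    Int.ediv_eq_zero_of_lt (by omega) (by exact_mod_cast r.2), zero_add]

theorem res_add_res (k : ℤ) (r : Fin n) : res n (n * k + (r : ℕ) : ℤ) = r := by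
  apply Fin.ext
  have h : (n * k + (r : ℕ) : ℤ) % n = (r : ℕ) := by
    rw [add_comm, Int.add_mul_emod_self_left,
      Int.emod_eq_of_lt (by omega) (by exact_mod_cast r.2)]
  simp only [res, h, Int.toNat_natCast]

theorem coe_res (i : ℤ) : (((res n i : Fin n) : ℕ) : ℤ) = i % n := by
  have := Int.emod_nonneg i (natCast_pos' n).ne'
  simp only [res]
  omega

theorem div_res_injective {i j : ℤ} (h1 : i / (n : ℤ) = j / n) (h2 : res n i = res n j) :
    i = j := by
  have h3 : i % n = j % n := by rw [← coe_res, ← coe_res, h2]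
  rw [← Int.emod_add_mul_ediv i n, ← Int.emod_add_mul_ediv j n, h1, h3]

theorem inner_e (i : ℤ) (f : HS n) :
    (inner ℂ (e n i) f : ℂ) =
      ∫ t : Torus, fourier (-(i / (n : ℤ))) t * (f t).ofLp (res n i)
        ∂AddCircle.haarAddCircle := by
  rw [L2.inner_def]
  refine integral_congr_ae ?_
  filter_upwards [ContinuousMap.coeFn_toLp (𝕜 := ℂ) (p := 2)
    (AddCircle.haarAddCircle : Measure Torus) (basisFun n i)] with t ht
  rw [show (e n i : Torus → EuclideanSpace ℂ (Fin n)) t = basisFun n i t from ht]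
  simp only [basisFun, ContinuousMap.coe_mk, inner_smul_left, EuclideanSpace.inner_single_left,
    map_one, one_mul, fourier_neg]

theorem e_ae (j : ℤ) : ∀ᵐ t ∂(AddCircle.haarAddCircle : Measure Torus),
    (e n j : Torus → EuclideanSpace ℂ (Fin n)) t =
      fourier (j / (n : ℤ)) t • EuclideanSpace.single (res n j) (1 : ℂ) :=
  ContinuousMap.coeFn_toLp (𝕜 := ℂ) (p := 2)
    (AddCircle.haarAddCircle : Measure Torus) (basisFun n j)

theorem orthonormal_e : Orthonormal ℂ (e n) := by
  rw [orthonormal_iff_ite]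
  intro i j
  rw [inner_e]
  have h1 : ∫ t : Torus, fourier (-(i / (n : ℤ))) t * (e n j t).ofLp (res n i)
      ∂AddCircle.haarAddCircle = ∫ t : Torus, fourier (-(i / (n : ℤ)) + j / n) t *
        (if res n i = res n j then 1 else 0) ∂AddCircle.haarAddCircle := by
    refine integral_congr_ae ?_
    filter_upwards [e_ae n j] with t ht
    rw [ht, fourier_add]
    simp only [PiLp.smul_apply, PiLp.single_apply, smul_eq_mul]
    split_ifs <;> simp
  rw [h1, integral_mul_const, integral_fourier]
  by_cases hij : i = j
  · simp [hij]
  · rw [if_neg hij]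
    by_cases h2 : i / (n : ℤ) = j / n
    · rw [if_neg fun h3 => hij (div_res_injective n h2 h3), mul_zero]
    · rw [if_neg (by omega), zero_mul]

/-- The Fourier coefficients of the component $f_r$ are the inner products with $e_{nk+r}$, so
completeness of the scalar Fourier basis applies to each component. -/
theorem eq_zero_of_inner_e (f : HS n) (h : ∀ i, (inner ℂ (e n i) f : ℂ) = 0) : f = 0 := by
  have hr : ∀ r : Fin n,
      (EuclideanSpace.proj r : EuclideanSpace ℂ (Fin n) →L[ℂ] ℂ).compLpL 2
        (AddCircle.haarAddCircle : Measure Torus) f = 0 := by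
    intro r
    have hb : ∀ k : ℤ, (fourierBasis (T := (1 : ℝ))).repr
        ((EuclideanSpace.proj r : EuclideanSpace ℂ (Fin n) →L[ℂ] ℂ).compLpL 2
          (AddCircle.haarAddCircle : Measure Torus) f) k = 0 := by
      intro k
      rw [fourierBasis_repr, fourierCoeff, ← h (n * k + (r : ℕ)), inner_e, div_add_res, res_add_res]
      refine integral_congr_ae ?_
      filter_upwards [ContinuousLinearMap.coeFn_compLpL (p := 2)
        (μ := (AddCircle.haarAddCircle : Measure Torus))
        (EuclideanSpace.proj r : EuclideanSpace ℂ (Fin n) →L[ℂ] ℂ) f] with t ht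
      rw [ht]
      rfl
    apply (fourierBasis (T := (1 : ℝ))).repr.injective
    rw [map_zero]
    ext k
    exact hb k
  have hae : ∀ᵐ t ∂(AddCircle.haarAddCircle : Measure Torus), ∀ r : Fin n, (f t).ofLp r = 0 := by
    rw [ae_all_iff]
    intro r
    have h1 := ContinuousLinearMap.coeFn_compLpL (p := 2)
        (μ := (AddCircle.haarAddCircle : Measure Torus))
        (EuclideanSpace.proj r : EuclideanSpace ℂ (Fin n) →L[ℂ] ℂ) f
    rw [hr r] at h1
    filter_upwards [h1, Lp.coeFn_zero ℂ 2 (AddCircle.haarAddCircle : Measure Torus)] with t h2 h3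
    rw [h3] at h2
    exact h2.symm
  apply Lp.ext
  filter_upwards [hae, Lp.coeFn_zero (EuclideanSpace ℂ (Fin n)) 2
    (AddCircle.haarAddCircle : Measure Torus)] with t h2 h3
  rw [h3]
  ext r
  exact h2 r

theorem ext_inner_e {f g : HS n} (h : ∀ i, (inner ℂ (e n i) f : ℂ) = inner ℂ (e n i) g) :
    f = g := by
  rw [← sub_eq_zero]
  exact eq_zero_of_inner_e n _ fun i => by rw [inner_sub_right, h i, sub_self]

/-- The vectors `e_i`, as a Hilbert basis of `H^n`. -/
def eBasis : HilbertBasis ℤ ℂ (HS n) :=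
  HilbertBasis.mkOfOrthogonalEqBot (orthonormal_e n) (by
    rw [Submodule.eq_bot_iff]
    intro f hf
    exact eq_zero_of_inner_e n f fun i =>
      (Submodule.mem_orthogonal _ _).1 hf _ (Submodule.subset_span ⟨i, rfl⟩))

theorem eBasis_apply (i : ℤ) : eBasis n i = e n i := by
  rw [eBasis, HilbertBasis.coe_mkOfOrthogonalEqBot]

theorem inner_ePlus_prPlus (i : ℕ) (f : HS n) :
    (inner ℂ (ePlus n i) (prPlus n f) : ℂ) = inner ℂ (e n i) f :=
  Submodule.inner_orthogonalProjectionOnto_eq_of_mem_left (ePlus n i) f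

theorem prPlus_coe (v : HPlus n) : prPlus n v = v :=
  Submodule.orthogonalProjectionOnto_mem_subspace_eq_self v

theorem inner_e_of_mem_HPlus {v : HS n} (hv : v ∈ HPlus n) {i : ℤ} (hi : i < 0) :
    (inner ℂ (e n i) v : ℂ) = 0 := by
  have h1 : HPlus n ≤ (innerSL ℂ (e n i)).ker := by
    refine Submodule.topologicalClosure_minimal _ ?_ (ContinuousLinearMap.isClosed_ker _)
    rw [Submodule.span_le]
    rintro _ ⟨j, hj, rfl⟩
    have hij : i ≠ j := by
      have : (0 : ℤ) ≤ j := hj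
      omega
    change (innerSL ℂ (e n i)) (e n j) = 0
    rw [innerSL_apply_apply, orthonormal_iff_ite.1 (orthonormal_e n) i j, if_neg hij]
  exact h1 hv

theorem inner_e_of_mem_HMinus {v : HS n} (hv : v ∈ HMinus n) {i : ℤ} (hi : 0 ≤ i) :
    (inner ℂ (e n i) v : ℂ) = 0 := by
  have h1 : HMinus n ≤ (innerSL ℂ (e n i)).ker := by
    refine Submodule.topologicalClosure_minimal _ ?_ (ContinuousLinearMap.isClosed_ker _)
    rw [Submodule.span_le]
    rintro _ ⟨j, hj, rfl⟩
    have hij : i ≠ j := by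
      have : j < (0 : ℤ) := hj
      omega
    change (innerSL ℂ (e n i)) (e n j) = 0
    rw [innerSL_apply_apply, orthonormal_iff_ite.1 (orthonormal_e n) i j, if_neg hij]
  exact h1 hv

theorem e_mem_HPlus {i : ℤ} (hi : 0 ≤ i) : e n i ∈ HPlus n :=
  Submodule.le_topologicalClosure _ (Submodule.subset_span ⟨i, hi, rfl⟩)

theorem e_mem_HMinus {i : ℤ} (hi : i < 0) : e n i ∈ HMinus n :=
  Submodule.le_topologicalClosure _ (Submodule.subset_span ⟨i, hi, rfl⟩)

theorem inner_e_prPlus {i : ℤ} (hi : 0 ≤ i) (f : HS n) :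
    (inner ℂ (e n i) (prPlus n f : HS n) : ℂ) = inner ℂ (e n i) f :=
  Submodule.inner_orthogonalProjectionOnto_eq_of_mem_left ⟨e n i, e_mem_HPlus n hi⟩ f

theorem inner_e_prMinus {i : ℤ} (hi : i < 0) (f : HS n) :
    (inner ℂ (e n i) (prMinus n f : HS n) : ℂ) = inner ℂ (e n i) f :=
  Submodule.inner_orthogonalProjectionOnto_eq_of_mem_left ⟨e n i, e_mem_HMinus n hi⟩ f

theorem prPlus_add_prMinus (f : HS n) : (prPlus n f : HS n) + prMinus n f = f := by
  refine ext_inner_e n fun i => ?_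
  rw [inner_add_right]
  rcases lt_or_ge i 0 with hi | hi
  · rw [inner_e_of_mem_HPlus n (prPlus n f).2 hi, inner_e_prMinus n hi, zero_add]
  · rw [inner_e_of_mem_HMinus n (prMinus n f).2 hi, inner_e_prPlus n hi, add_zero]

theorem mem_HPlus_iff {v : HS n} : v ∈ HPlus n ↔ ∀ i : ℤ, i < 0 → (inner ℂ (e n i) v : ℂ) = 0 := by
  refine ⟨fun hv i hi => inner_e_of_mem_HPlus n hv hi, fun h => ?_⟩
  have h1 : (prPlus n v : HS n) = v := by
    refine ext_inner_e n fun i => ?_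
    rcases lt_or_ge i 0 with hi | hi
    · rw [inner_e_of_mem_HPlus n (prPlus n v).2 hi, h i hi]
    · rw [inner_e_prPlus n hi]
  rw [← h1]
  exact (prPlus n v).2

theorem prMinus_of_mem_HPlus {v : HS n} (hv : v ∈ HPlus n) : prMinus n v = 0 := by
  have h1 := prPlus_add_prMinus n v
  have h2 : prPlus n v = ⟨v, hv⟩ := prPlus_coe n ⟨v, hv⟩
  rw [h2] at h1
  exact Subtype.ext (by simpa using h1)

theorem ext_inner_ePlus {u v : HPlus n}
    (h : ∀ i : ℕ, (inner ℂ (ePlus n i) u : ℂ) = inner ℂ (ePlus n i) v) : u = v := by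
  refine Subtype.ext (ext_inner_e n fun i => ?_)
  rcases lt_or_ge i 0 with hi | hi
  · rw [inner_e_of_mem_HPlus n u.2 hi, inner_e_of_mem_HPlus n v.2 hi]
  · obtain ⟨k, rfl⟩ := Int.eq_ofNat_of_zero_le hi
    exact h k

/-- The vectors `e_i` with `i ≥ 0`, as a Hilbert basis of `H^n_+`. -/
def ePlusBasis : HilbertBasis ℕ ℂ (HPlus n) :=
  HilbertBasis.mkOfOrthogonalEqBot (v := ePlus n)
    (by
      rw [orthonormal_iff_ite]
      intro i j
      have := orthonormal_iff_ite.1 (orthonormal_e n) (i : ℤ) (j : ℤ)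
      simp only [Nat.cast_inj] at this
      exact this)
    (by
      rw [Submodule.eq_bot_iff]
      intro f hf
      refine ext_inner_ePlus n fun i => ?_
      rw [inner_zero_right]
      exact (Submodule.mem_orthogonal _ _).1 hf _ (Submodule.subset_span ⟨i, rfl⟩))

theorem ePlusBasis_apply (i : ℕ) : ePlusBasis n i = ePlus n i := by
  rw [ePlusBasis, HilbertBasis.coe_mkOfOrthogonalEqBot]

theorem norm_e (i : ℤ) : ‖e n i‖ = 1 := (orthonormal_e n).1 i

theorem norm_ePlus (i : ℕ) : ‖ePlus n i‖ = 1 := norm_e n i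

/-- The expansion of the `H^n_-`-component. -/
theorem hasSum_prMinus (f : HS n) :
    HasSum (fun i : ℕ => (inner ℂ (e n (-((i : ℤ) + 1))) f : ℂ) • e n (-((i : ℤ) + 1)))
      (prMinus n f : HS n) := by
  have h1 := (eBasis n).hasSum_repr (prMinus n f : HS n)
  simp only [HilbertBasis.repr_apply_apply, eBasis_apply] at h1
  have hinj : Function.Injective fun i : ℕ => -((i : ℤ) + 1) := fun a b h => by
    simp only at h
    omega
  rw [← hinj.hasSum_iff] at h1
  · refine h1.congr_fun fun i => ?_
    simp only [Function.comp_apply]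
    rw [inner_e_prMinus n (by omega)]
  · intro i hi
    have : 0 ≤ i := by
      by_contra h
      exact hi ⟨(-i - 1).toNat, by simp only; omega⟩
    rw [inner_e_of_mem_HMinus n (prMinus n f).2 this, zero_smul]

end Basis

/-! ### The matrix of a multiplication operator -/

section MulOp

variable {n : ℕ}

theorem MatrixFun.summable_norm_coeff (g : MatrixFun n) (i j : Fin n) :
    Summable fun k => ‖g.coeff k i j‖ := by
  obtain ⟨R, hR, hs⟩ := g.summable
  have := hs 1 (by simpa using hR)
  simp only [one_pow, one_smul] at this
  exact ((Pi.summable.1 ((Pi.summable.1 this) i)) j).norm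

theorem MatrixFun.hasSum_eval (g : MatrixFun n) {z : ℂ} (hz : ‖z‖ ≤ 1) (i j : Fin n) :
    HasSum (fun k => z ^ k * g.coeff k i j) (g.eval z i j) := by
  obtain ⟨R, hR, hs⟩ := g.summable
  exact Pi.hasSum.1 (Pi.hasSum.1 (hs z (hz.trans_lt hR)).hasSum i) j

theorem zc_pow (t : Torus) (k : ℕ) : zc t ^ k = fourier (k : ℤ) t := by
  rw [fourier_apply, AddCircle.toCircle_zsmul]
  simp [zc]

/-- The matrix of multiplication by `g` is the block Toeplitz matrix. -/
theorem MatrixFun.inner_e_mulOp_e [NeZero n] (g : MatrixFun n) (l s : ℤ) :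
    (inner ℂ (e n l) (g.mulOp (e n s)) : ℂ) = blockToeplitz n g.coeff l s := by
  have h1 : (inner ℂ (e n l) (g.mulOp (e n s)) : ℂ) = ∫ t : Torus, ∑' k : ℕ,
      fourier ((k : ℤ) + (s / n - l / n)) t * g.coeff k (res n l) (res n s)
        ∂AddCircle.haarAddCircle := by
    rw [inner_e]
    refine integral_congr_ae ?_
    filter_upwards [g.mulOp_apply (e n s), e_ae n s] with t h2 h3
    rw [h2, h3]
    have h4 : (WithLp.ofLp (fourier (s / (n : ℤ)) t •
        EuclideanSpace.single (res n s) (1 : ℂ))) =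
        Pi.single (res n s) (fourier (s / (n : ℤ)) t) := by
      ext r
      simp [Pi.single_apply]
    simp only [h4, Matrix.mulVec_single]
    have h5 := g.hasSum_eval (z := zc t) (norm_zc t).le (res n l) (res n s)
    have h6 := (h5.mul_left (fourier (s / (n : ℤ) - l / n) t)).tsum_eq
    simp only [Pi.smul_apply, Matrix.col_apply, MulOpposite.smul_eq_mul_unop,
      MulOpposite.unop_op]
    rw [← mul_assoc, mul_right_comm, ← fourier_add, neg_add_eq_sub, ← h6]
    refine tsum_congr fun k => ?_
    rw [zc_pow, ← mul_assoc, ← fourier_add, add_comm]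
  rw [h1]
  -- The coefficients are absolutely summable, so the series is integrated termwise; only $k=\lfloor
  -- l/n\rfloor-\lfloor s/n\rfloor$ survives.
  have h2 := hasSum_integral_of_summable_integral_norm
    (μ := (AddCircle.haarAddCircle : Measure Torus))
    (F := fun (k : ℕ) t => fourier ((k : ℤ) + (s / n - l / n)) t * g.coeff k (res n l) (res n s))
    (fun k => (((fourier (T := 1) ((k : ℤ) + (s / n - l / n))).continuous.mul
      continuous_const).integrable_of_hasCompactSupport
        (HasCompactSupport.of_compactSpace _))) (by
      have h3 : ∀ k : ℕ, ∫ t : Torus, ‖fourier ((k : ℤ) + (s / n - l / n)) t *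
          g.coeff k (res n l) (res n s)‖ ∂AddCircle.haarAddCircle =
          ‖g.coeff k (res n l) (res n s)‖ := by
        intro k
        have h4 : ∀ t : Torus, ‖fourier ((k : ℤ) + (s / n - l / n)) t *
            g.coeff k (res n l) (res n s)‖ = ‖g.coeff k (res n l) (res n s)‖ := by
          intro t
          rw [norm_mul, fourier_apply, Circle.norm_coe, one_mul]
        simp only [h4]
        simp
      simp only [h3]
      exact g.summable_norm_coeff _ _)
  rw [← h2.tsum_eq]
  simp only [integral_mul_const, integral_fourier]
  rw [blockToeplitz]
  split_ifs with h
  · rw [tsum_eq_single (l / (n : ℤ) - s / n).toNat]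
    · rw [if_pos (by omega), one_mul]
    · intro k hk
      rw [if_neg (by omega), zero_mul]
  · rw [tsum_eq_single 0 fun k _ => by rw [if_neg (by omega), zero_mul], if_neg (by omega),
      zero_mul]

/-- The Toeplitz matrix is block lower triangular. Hence the projection in `opA` does nothing and
$a$ is the restriction of $g$. -/
theorem MatrixFun.mulOp_mem_HPlus [NeZero n] (g : MatrixFun n) {v : HS n} (hv : v ∈ HPlus n) :
    g.mulOp v ∈ HPlus n := by
  have h1 : HPlus n ≤ (HPlus n).comap g.mulOp.toLinearMap := by
    refine Submodule.topologicalClosure_minimal _ ?_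
      ((Submodule.isClosed_topologicalClosure _).preimage g.mulOp.continuous)
    rw [Submodule.span_le]
    rintro _ ⟨s, hs, rfl⟩
    change g.mulOp (e n s) ∈ HPlus n
    rw [mem_HPlus_iff]
    intro l hl
    rw [g.inner_e_mulOp_e, blockToeplitz, if_neg]
    have h2 := Int.ediv_nonneg (show (0 : ℤ) ≤ s from hs) (natCast_pos' n).le
    have h3 := Int.ediv_neg_of_neg_of_pos hl (natCast_pos' n)
    omega
  exact h1 hv

theorem MatrixFun.coe_opA [NeZero n] (g : MatrixFun n) (v : HPlus n) :
    ((g.opA v : HPlus n) : HS n) = g.mulOp v :=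
  congrArg Subtype.val (prPlus_coe n ⟨g.mulOp v, g.mulOp_mem_HPlus v.2⟩)

theorem MatrixFun.inner_ePlus_opA [NeZero n] (g : MatrixFun n) (l m : ℕ) :
    (inner ℂ (ePlus n l) (g.opA (ePlus n m)) : ℂ) = blockToeplitz n g.coeff l m := by
  rw [← g.inner_e_mulOp_e]
  change (inner ℂ (e n l) ((g.opA (ePlus n m) : HPlus n) : HS n) : ℂ) = _
  rw [g.coe_opA]
  rfl

theorem MatrixFun.mulOp_mulOp (g h : MatrixFun n)
    (hgh : ∀ z : ℂ, ‖z‖ ≤ 1 → h.eval z * g.eval z = 1) (f : HS n) : h.mulOp (g.mulOp f) = f := by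
  apply Lp.ext
  filter_upwards [h.mulOp_apply (g.mulOp f), g.mulOp_apply f] with t h1 h2
  rw [h1, h2]
  simp only [Matrix.mulVec_mulVec, hgh _ (norm_zc t).le, Matrix.one_mulVec]

end MulOp

/-! ### The inverse of a matrix function -/

section Inverse

variable {n : ℕ}

/-- Summability at a point strictly between 1 and $R$ is absolute in each entry; this gives
analyticity and geometric decay. -/
theorem MatrixFun.exists_summable_mul_pow (g : MatrixFun n) :
    ∃ r : ℝ, 1 < r ∧ ∀ i j, Summable fun k => r ^ k * ‖g.coeff k i j‖ := by
  obtain ⟨R, hR, hs⟩ := g.summable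
  refine ⟨(1 + R) / 2, by linarith, fun i j => ?_⟩
  have h1 := hs (((1 + R) / 2 : ℝ) : ℂ) (by
    rw [Complex.norm_real, Real.norm_of_nonneg (by linarith)]
    linarith)
  have h2 := ((Pi.summable.1 ((Pi.summable.1 h1) i)) j).norm
  refine h2.congr fun k => ?_
  rw [Matrix.smul_apply, smul_eq_mul, norm_mul, norm_pow, Complex.norm_real,
    Real.norm_of_nonneg (by linarith)]

theorem MatrixFun.exists_differentiableOn (g : MatrixFun n) :
    ∃ r : ℝ, 1 < r ∧ ∀ i j, DifferentiableOn ℂ (fun z => g.eval z i j) (Metric.ball 0 r) := by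
  obtain ⟨r, hr, hs⟩ := g.exists_summable_mul_pow
  obtain ⟨R, hR, hsum⟩ := g.summable
  refine ⟨min r R, lt_min hr hR, fun i j => ?_⟩
  have h1 : ∀ z ∈ Metric.ball (0 : ℂ) (min r R), g.eval z i j =
      ∑' k : ℕ, z ^ k * g.coeff k i j := by
    intro z hz
    rw [mem_ball_zero_iff, lt_min_iff] at hz
    exact (Pi.hasSum.1 (Pi.hasSum.1 (hsum z hz.2).hasSum i) j).tsum_eq.symm
  refine DifferentiableOn.congr ?_ h1
  refine Complex.differentiableOn_tsum_of_summable_norm (hs i j)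
    (fun k => ((differentiable_id.pow k).mul_const _).differentiableOn) Metric.isOpen_ball
    fun k z hz => ?_
  rw [mem_ball_zero_iff, lt_min_iff] at hz
  rw [norm_mul, norm_pow]
  gcongr
  exact hz.1.le

theorem differentiableOn_det {m : Type*} [Fintype m] [DecidableEq m] {A : ℂ → Matrix m m ℂ}
    {U : Set ℂ} (h : ∀ i j, DifferentiableOn ℂ (fun z => A z i j) U) :
    DifferentiableOn ℂ (fun z => (A z).det) U := by
  simp only [Matrix.det_apply]
  refine DifferentiableOn.fun_sum fun σ _ => DifferentiableOn.const_smul ?_ _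
  exact DifferentiableOn.fun_finsetProd fun i _ => h _ _

/-- The pointwise inverse of `g` is again a function of the same type. -/
theorem MatrixFun.exists_inverse (g : MatrixFun n) :
    ∃ h : MatrixFun n, ∀ z : ℂ, ‖z‖ ≤ 1 → h.eval z = (g.eval z)⁻¹ := by
  obtain ⟨r, hr, hd⟩ := g.exists_differentiableOn
  have hdet := differentiableOn_det hd
  set U : Set ℂ := Metric.ball 0 r ∩ (fun z => (g.eval z).det) ⁻¹' {0}ᶜ with hU
  have hUo : IsOpen U := hdet.continuousOn.isOpen_inter_preimage Metric.isOpen_ball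
    isOpen_compl_singleton
  have hsub : Metric.closedBall (0 : ℂ) 1 ⊆ U := by
    intro z hz
    rw [mem_closedBall_zero_iff] at hz
    refine ⟨mem_ball_zero_iff.2 (hz.trans_lt hr), ?_⟩
    exact ((Matrix.isUnit_iff_isUnit_det _).1 (g.isUnit z hz)).ne_zero
  -- By compactness the determinant is nonzero on a larger disc; there Cramer's rule makes the
  -- inverse analytic, and its Taylor series gives the coefficients.
  obtain ⟨δ, hδ, hδU⟩ := (isCompact_closedBall (0 : ℂ) 1).exists_thickening_subset_open hUo hsub
  rw [thickening_closedBall hδ zero_le_one] at hδU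
  have hinv : ∀ i j, DifferentiableOn ℂ (fun z => (g.eval z)⁻¹ i j) (Metric.ball 0 (δ + 1)) := by
    intro i j
    have h1 : ∀ z, (g.eval z)⁻¹ i j =
        ((g.eval z).det)⁻¹ * ((g.eval z).updateRow j (Pi.single i 1)).det := by
      intro z
      rw [Matrix.inv_def, Ring.inverse_eq_inv', Matrix.smul_apply, Matrix.adjugate_apply,
        smul_eq_mul]
    simp only [h1]
    refine DifferentiableOn.mul ?_ ?_
    · exact (hdet.mono fun z hz => (hδU hz).1).inv fun z hz => (hδU hz).2
    · refine differentiableOn_det fun k l => ?_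
      simp only [Matrix.updateRow_apply]
      split_ifs
      · exact differentiableOn_const _
      · exact (hd k l).mono fun z hz => (hδU hz).1
  have hsum : ∀ z : ℂ, ‖z‖ < δ + 1 → HasSum (fun k : ℕ => z ^ k • Matrix.of fun i j =>
      ((k.factorial : ℂ)⁻¹ * iteratedDeriv k (fun z => (g.eval z)⁻¹ i j) 0)) (g.eval z)⁻¹ := by
    intro z hz
    refine Pi.hasSum.2 fun i => Pi.hasSum.2 fun j => ?_
    have h2 := Complex.hasSum_taylorSeries_on_ball (hinv i j) (mem_ball_zero_iff.2 hz)
    refine h2.congr_fun fun k => ?_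
    simp only [Matrix.smul_apply, Matrix.of_apply, smul_eq_mul, sub_zero]
    ring
  refine ⟨⟨fun k => Matrix.of fun i j =>
      ((k.factorial : ℂ)⁻¹ * iteratedDeriv k (fun z => (g.eval z)⁻¹ i j) 0),
    ⟨δ + 1, by linarith, fun z hz => (hsum z hz).summable⟩, fun z hz => ?_⟩, fun z hz => ?_⟩
  · rw [(hsum z (by linarith)).tsum_eq, Matrix.isUnit_nonsing_inv_iff]
    exact g.isUnit z hz
  · exact (hsum z (by linarith)).tsum_eq

theorem MatrixFun.isUnit_coeff_zero (g : MatrixFun n) : IsUnit (g.coeff 0) := by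
  have h := g.isUnit 0 (by simp)
  rwa [tsum_eq_single 0 fun k hk => by rw [zero_pow hk, zero_smul], pow_zero, one_smul] at h

/-- The pointwise inverse of `g`. -/
def MatrixFun.inverse (g : MatrixFun n) : MatrixFun n := Classical.choose g.exists_inverse

theorem MatrixFun.eval_inverse (g : MatrixFun n) {z : ℂ} (hz : ‖z‖ ≤ 1) :
    g.inverse.eval z = (g.eval z)⁻¹ :=
  Classical.choose_spec g.exists_inverse z hz

theorem MatrixFun.inverse_mul_eval (g : MatrixFun n) {z : ℂ} (hz : ‖z‖ ≤ 1) :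
    g.inverse.eval z * g.eval z = 1 := by
  rw [g.eval_inverse hz]
  exact Matrix.nonsing_inv_mul _ ((Matrix.isUnit_iff_isUnit_det _).1 (g.isUnit z hz))

theorem MatrixFun.eval_mul_inverse (g : MatrixFun n) {z : ℂ} (hz : ‖z‖ ≤ 1) :
    g.eval z * g.inverse.eval z = 1 := by
  rw [g.eval_inverse hz]
  exact Matrix.mul_nonsing_inv _ ((Matrix.isUnit_iff_isUnit_det _).1 (g.isUnit z hz))

theorem MatrixFun.inverse_mulOp (g : MatrixFun n) (f : HS n) :
    g.inverse.mulOp (g.mulOp f) = f :=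
  g.mulOp_mulOp g.inverse (fun _ hz => g.inverse_mul_eval hz) f

theorem MatrixFun.mulOp_inverse (g : MatrixFun n) (f : HS n) :
    g.mulOp (g.inverse.mulOp f) = f :=
  g.inverse.mulOp_mulOp g (fun _ hz => g.eval_mul_inverse hz) f

variable [NeZero n]

/-- Both $g$ and $g^{-1}$ preserve $H^n_+$, so their compressions are restrictions and compose
without correction. -/
theorem MatrixFun.opA_inverse_comp (g : MatrixFun n) :
    g.inverse.opA ∘L g.opA = ContinuousLinearMap.id ℂ (HPlus n) := by
  ext1 v
  apply Subtype.ext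
  rw [ContinuousLinearMap.comp_apply, MatrixFun.coe_opA, MatrixFun.coe_opA, g.inverse_mulOp]
  rfl

theorem MatrixFun.opA_comp_inverse (g : MatrixFun n) :
    g.opA ∘L g.inverse.opA = ContinuousLinearMap.id ℂ (HPlus n) := by
  ext1 v
  apply Subtype.ext
  rw [ContinuousLinearMap.comp_apply, MatrixFun.coe_opA, MatrixFun.coe_opA, g.mulOp_inverse]
  rfl

theorem MatrixFun.isUnit_opA (g : MatrixFun n) : IsUnit g.opA :=
  ⟨⟨g.opA, g.inverse.opA, g.opA_comp_inverse, g.opA_inverse_comp⟩, rfl⟩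

theorem MatrixFun.inverse_opA (g : MatrixFun n) : Ring.inverse g.opA = g.inverse.opA :=
  Ring.inverse_unit (⟨g.opA, g.inverse.opA, g.opA_comp_inverse, g.opA_inverse_comp⟩ :
    (HPlus n →L[ℂ] HPlus n)ˣ)

theorem hasSum_inner_comp (A B : HPlus n →L[ℂ] HPlus n) (l : ℕ) (v : HPlus n) :
    HasSum (fun p => (inner ℂ (ePlus n l) (A (ePlus n p)) : ℂ) * inner ℂ (ePlus n p) (B v))
      (inner ℂ (ePlus n l) (A (B v))) := by
  have h := (ePlusBasis n).hasSum_inner_mul_inner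
    (ContinuousLinearMap.adjoint A (ePlus n l)) (B v)
  simpa only [ePlusBasis_apply, ContinuousLinearMap.adjoint_inner_left] using h

/-- The coefficients of the inverse function are the coefficients of the inverse power series. -/
theorem MatrixFun.inverse_coeff (g : MatrixFun n) : g.inverse.coeff = invCoeff n g.coeff := by
  have hu := isUnit_mk n g.isUnit_coeff_zero
  set C : ℕ → Matrix (Fin n) (Fin n) ℂ := fun k =>
    PowerSeries.coeff k (PowerSeries.mk g.inverse.coeff * PowerSeries.mk g.coeff) with hC
  have h1 := infMul_MS_base n g.inverse.coeff g.coeff C (by ext1 k; simp [hC])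
  have h2 : infMul (MS n g.inverse.coeff SSet.base) (MS n g.coeff SSet.base) = 1 := by
    ext l m
    have h3 := hasSum_inner_comp g.inverse.opA g.opA l (ePlus n m)
    have h4 : g.inverse.opA (g.opA (ePlus n m)) = ePlus n m :=
      congrArg (fun T : HPlus n →L[ℂ] HPlus n => T (ePlus n m)) g.opA_inverse_comp
    have h5 := orthonormal_iff_ite.1 (ePlusBasis n).orthonormal l m
    rw [ePlusBasis_apply, ePlusBasis_apply] at h5
    rw [h4, h5] at h3
    simp only [MatrixFun.inner_ePlus_opA] at h3
    simp only [infMul, MS, SSet.base, Matrix.of_apply, Matrix.one_apply]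
    rw [← h3.tsum_eq, tsum_eq_finsum]
    refine (Finset.range (n * (l / n + 1))).finite_toSet.subset fun p hp => ?_
    by_contra hp'
    simp only [Finset.coe_range, Set.mem_Iio, not_lt] at hp'
    have h6 : l / n + 1 ≤ p / n := by
      rw [Nat.le_div_iff_mul_le (Nat.pos_of_ne_zero (NeZero.ne n)), mul_comm]
      exact hp'
    apply hp
    simp only [blockToeplitz]
    simp only [← Int.natCast_div, Nat.cast_le]
    rw [if_neg (show ¬ p / n ≤ l / n by omega), zero_mul]
  rw [h1, ← MS_base_one n] at h2
  -- The first block column of a block Toeplitz matrix lists the coefficients of its power series.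
  have h3 : PowerSeries.mk g.inverse.coeff * PowerSeries.mk g.coeff = 1 := by
    ext k i j
    have h4 := congrFun (congrFun h2 (n * k + i)) j
    have e1 := div_block n k i
    have e2 := res_block n k i
    have e3 := div_block n 0 j
    have e4 := res_block n 0 j
    simp only [mul_zero, zero_add, Nat.cast_zero] at e3 e4
    simp only [MS, SSet.base, Matrix.of_apply, blockToeplitz, e1, e2, e3, e4] at h4
    rw [if_pos (by omega), if_pos (by omega), sub_zero, Int.toNat_natCast] at h4
    exact h4
  have h4 : PowerSeries.mk g.inverse.coeff = Ring.inverse (PowerSeries.mk g.coeff) := by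
    have := congrArg (· * Ring.inverse (PowerSeries.mk g.coeff)) h3
    simpa only [mul_assoc, Ring.mul_inverse_cancel _ hu, mul_one, one_mul] using this
  funext k
  rw [invCoeff, ← h4, PowerSeries.coeff_mk]

theorem MatrixFun.inner_ePlus_inverse_opA (g : MatrixFun n) (l m : ℕ) :
    (inner ℂ (ePlus n l) (g.inverse.opA (ePlus n m)) : ℂ) = M0inv n g.coeff l m := by
  rw [MatrixFun.inner_ePlus_opA, g.inverse_coeff]
  rfl

end Inverse

/-! ### Decay of the coefficients -/

section Decay

variable {n : ℕ}

theorem MatrixFun.exists_decay (g : MatrixFun n) : ∃ θ C : ℝ, 0 < θ ∧ θ < 1 ∧ 0 ≤ C ∧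
    ∀ k i j, ‖g.coeff k i j‖ ≤ C * θ ^ k := by
  obtain ⟨r, hr, hs⟩ := g.exists_summable_mul_pow
  have hr0 : 0 < r := zero_lt_one.trans hr
  have h0 : ∀ i j, 0 ≤ ∑' k, r ^ k * ‖g.coeff k i j‖ := fun i j =>
    tsum_nonneg fun k => by positivity
  refine ⟨r⁻¹, ∑ i, ∑ j, ∑' k, r ^ k * ‖g.coeff k i j‖, by positivity, inv_lt_one_of_one_lt₀ hr,
    Finset.sum_nonneg fun i _ => Finset.sum_nonneg fun j _ => h0 i j, fun k i j => ?_⟩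
  have h1 : r ^ k * ‖g.coeff k i j‖ ≤ ∑ i, ∑ j, ∑' k, r ^ k * ‖g.coeff k i j‖ :=
    ((hs i j).le_tsum k fun _ _ => by positivity).trans
      ((Finset.single_le_sum (f := fun j => ∑' k, r ^ k * ‖g.coeff k i j‖) (fun j _ => h0 i j)
        (Finset.mem_univ j)).trans (Finset.single_le_sum
          (f := fun i => ∑ j, ∑' k, r ^ k * ‖g.coeff k i j‖)
          (fun i _ => Finset.sum_nonneg fun j _ => h0 i j) (Finset.mem_univ i)))
  rw [inv_pow, ← div_eq_mul_inv, le_div_iff₀ (by positivity), mul_comm]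
  exact h1

theorem exists_common_decay (g h : MatrixFun n) : ∃ θ C : ℝ, 0 < θ ∧ θ < 1 ∧ 0 ≤ C ∧
    (∀ k i j, ‖g.coeff k i j‖ ≤ C * θ ^ k) ∧ ∀ k i j, ‖h.coeff k i j‖ ≤ C * θ ^ k := by
  obtain ⟨θ, C, h1, h2, h3, h4⟩ := g.exists_decay
  obtain ⟨θ', C', h1', h2', h3', h4'⟩ := h.exists_decay
  refine ⟨max θ θ', max C C', lt_max_of_lt_left h1, max_lt h2 h2', le_max_of_le_left h3,
    fun k i j => (h4 k i j).trans ?_, fun k i j => (h4' k i j).trans ?_⟩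
  · exact mul_le_mul (le_max_left _ _) (pow_le_pow_left₀ h1.le (le_max_left _ _) k) (by positivity)
      (le_max_of_le_left h3)
  · exact mul_le_mul (le_max_right _ _) (pow_le_pow_left₀ h1'.le (le_max_right _ _) k)
      (by positivity) (le_max_of_le_left h3)

/-- Each value of $\lfloor l/n\rfloor$ is taken exactly $n$ times. -/
theorem summable_comp_div [NeZero n] {f : ℕ → ℝ} (hf0 : ∀ k, 0 ≤ f k) (hf : Summable f) :
    Summable fun l => f (l / n) := by
  have h1 : Summable fun p : ℕ × Fin n => f p.1 * 1 :=
    hf.mul_of_nonneg (g := fun _ : Fin n => (1 : ℝ)) (Summable.of_finite) hf0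
      (fun _ => zero_le_one)
  have h2 := h1.comp_injective (Nat.divModEquiv n).injective
  refine h2.congr fun l => ?_
  simp

theorem norm_blockToeplitz_le [NeZero n] {H : ℕ → Matrix (Fin n) (Fin n) ℂ} {θ C : ℝ}
    (hθ : 0 < θ) (hC : 0 ≤ C) (h : ∀ k i j, ‖H k i j‖ ≤ C * θ ^ k) (l s : ℤ) :
    ‖blockToeplitz n H l s‖ ≤ C * θ ^ (l / (n : ℤ) - s / n) := by
  rw [blockToeplitz]
  split_ifs with h1
  · refine (h _ _ _).trans_eq ?_
    rw [← zpow_natCast, Int.toNat_of_nonneg (by omega)]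
  · rw [norm_zero]
    positivity

theorem neg_succ_div [NeZero n] (i : ℕ) :
    (-((i : ℤ) + 1)) / (n : ℤ) = -(((i / n : ℕ) : ℤ) + 1) := by
  refine ((Int.ediv_emod_unique (natCast_pos' n) (r := (n : ℤ) - 1 - (i % n : ℕ))).2
    ⟨?_, ?_, ?_⟩).1
  · have h1 : (n : ℤ) * (i / n : ℕ) + (i % n : ℕ) = i := by exact_mod_cast Nat.div_add_mod i n
    linear_combination -h1
  · have := Nat.mod_lt i (Nat.pos_of_ne_zero (NeZero.ne n))
    omega
  · omega

/-- The entries of `a⁻¹ pr_+ g` in the columns with negative index decay in both indices. -/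
theorem MatrixFun.norm_inner_inverse_opA_prPlus_le [NeZero n] (g : MatrixFun n) {θ C : ℝ}
    (hθ : 0 < θ) (hC : 0 ≤ C) (h1 : ∀ k i j, ‖g.coeff k i j‖ ≤ C * θ ^ k)
    (h2 : ∀ k i j, ‖g.inverse.coeff k i j‖ ≤ C * θ ^ k) (l i : ℕ) :
    ‖(inner ℂ (ePlus n l) (g.inverse.opA (prPlus n (g.mulOp (e n (-((i : ℤ) + 1)))))) : ℂ)‖ ≤
      (((l / n : ℕ) : ℝ) + 1) * θ ^ (l / n) * (n * C ^ 2 * θ ^ (i / n + 1)) := by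
  set s : ℤ := -((i : ℤ) + 1) with hs
  have h3 := hasSum_inner_comp g.inverse.opA (ContinuousLinearMap.id ℂ (HPlus n)) l
    (prPlus n (g.mulOp (e n s)))
  simp only [ContinuousLinearMap.id_apply, inner_ePlus_prPlus, MatrixFun.inner_ePlus_opA,
    MatrixFun.inner_e_mulOp_e] at h3
  have h4 := hasSum_sum_of_ne_finset_zero (L := SummationFilter.unconditional ℕ)
    (f := fun p : ℕ => blockToeplitz n g.inverse.coeff l p * blockToeplitz n g.coeff p s)
    (s := Finset.range (n * (l / n + 1))) fun p hp => by
      rw [Finset.mem_range, not_lt] at hp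
      have h6 : l / n + 1 ≤ p / n := by
        rw [Nat.le_div_iff_mul_le (Nat.pos_of_ne_zero (NeZero.ne n)), mul_comm]
        exact hp
      simp only [blockToeplitz]
      simp only [← Int.natCast_div, Nat.cast_le]
      rw [if_neg (show ¬ p / n ≤ l / n by omega), zero_mul]
  rw [h3.unique h4]
  -- The exponents $\lfloor l/n\rfloor-\lfloor p/n\rfloor$ and $\lfloor p/n\rfloor+\lfloor
  -- i/n\rfloor+1$ add up to a number independent of $p$; the $n(\lfloor l/n\rfloor+1)$ terms
  -- account for the linear factor.
  refine (norm_sum_le _ _).trans ((Finset.sum_le_sum (g := fun _ =>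
    C ^ 2 * (θ ^ (l / n) * θ ^ (i / n + 1))) fun p _ => ?_).trans_eq ?_)
  · rw [norm_mul]
    refine (mul_le_mul (norm_blockToeplitz_le hθ hC h2 _ _) (norm_blockToeplitz_le hθ hC h1 _ _)
      (norm_nonneg _) (by positivity)).trans_eq ?_
    rw [mul_mul_mul_comm, ← zpow_add₀ hθ.ne', ← pow_add, ← sq, hs, neg_succ_div,
      ← Int.natCast_div l, ← zpow_natCast θ (l / n + _)]
    congr 2
    push_cast
    ring
  · rw [Finset.sum_const, Finset.card_range, nsmul_eq_mul]
    push_cast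
    ring

/-- Entry $l$ of column $i$ is at most $C\theta^{\lfloor l/n\rfloor+\lfloor i/n\rfloor+1}$. Summing
over $l$ bounds the norm of the column by a constant times $\theta^{\lfloor i/n\rfloor}$. -/
theorem MatrixFun.summable_norm_prPlus_mulOp [NeZero n] (g : MatrixFun n) :
    Summable fun i : ℕ => ‖prPlus n (g.mulOp (e n (-((i : ℤ) + 1))))‖ := by
  obtain ⟨θ, C, h1, h2, h3, h4⟩ := g.exists_decay
  have hgeo : Summable fun l : ℕ => θ ^ (l / n) :=
    summable_comp_div (fun k => pow_nonneg h1.le k) (summable_geometric_of_lt_one h1.le h2)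
  refine Summable.of_nonneg_of_le (fun _ => norm_nonneg _) (fun i => ?_)
    (hgeo.mul_left (C * θ * ∑' l : ℕ, θ ^ (l / n)))
  set v := prPlus n (g.mulOp (e n (-((i : ℤ) + 1))))
  have h5 := (ePlusBasis n).hasSum_repr v
  simp only [HilbertBasis.repr_apply_apply, ePlusBasis_apply] at h5
  have h6 : ∀ l : ℕ, ‖(inner ℂ (ePlus n l) v : ℂ) • ePlus n l‖ ≤
      C * θ * θ ^ (i / n) * θ ^ (l / n) := by
    intro l
    rw [norm_smul, norm_ePlus, mul_one, inner_ePlus_prPlus, MatrixFun.inner_e_mulOp_e]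
    refine (norm_blockToeplitz_le h1 h3 h4 _ _).trans_eq ?_
    rw [neg_succ_div, mul_assoc C, mul_assoc C, ← pow_succ', ← pow_add, ← zpow_natCast,
      ← Int.natCast_div]
    congr 2
    push_cast
    ring
  have h7 := tsum_of_norm_bounded (hgeo.mul_left (C * θ * θ ^ (i / n))).hasSum h6
  rw [h5.tsum_eq, tsum_mul_left] at h7
  linarith

/-- The Hankel operator `pr_+ g pr_-` is of trace class. -/
theorem MatrixFun.isTraceClass_hankel [NeZero n] (g : MatrixFun n) :
    IsTraceClass (prPlus n ∘L g.mulOp ∘L (HMinus n).subtypeL ∘L prMinus n) := by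
  refine ⟨fun i => e n (-((i : ℤ) + 1)), fun i => prPlus n (g.mulOp (e n (-((i : ℤ) + 1)))), ?_,
    fun v => ?_⟩
  · simpa only [norm_e, one_mul] using g.summable_norm_prPlus_mulOp
  · simpa using (hasSum_prMinus n v).mapL (prPlus n ∘L g.mulOp)

end Decay

/-! ### Fredholm operators of index zero -/

section Index

theorem range_le_of_mem {K V : Type*} [Field K] [AddCommGroup V] [Module K V] (G : V →ₗ[K] V)
    (x : V) (h : x + G x ∈ G.range) : x ∈ G.range := by
  have := G.range.sub_mem h ⟨x, rfl⟩
  rwa [add_sub_cancel_right] at this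

/-- A perturbation of the identity by a map of finite rank has finite dimensional kernel and
cokernel of the same dimension. -/
theorem index_id_add_of_finiteRange {K V : Type*} [Field K] [AddCommGroup V] [Module K V]
    (G : V →ₗ[K] V) [FiniteDimensional K G.range] :
    FiniteDimensional K (LinearMap.id + G).ker ∧
      FiniteDimensional K (V ⧸ (LinearMap.id + G).range) ∧ (LinearMap.id + G).index = 0 := by
  set f : V →ₗ[K] V := LinearMap.id + G
  have hf : ∀ x, f x = x + G x := fun x => rfl
  have hmaps : ∀ x ∈ G.range, f x ∈ G.range := fun x hx => G.range.add_mem hx ⟨x, rfl⟩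
  -- The kernel of $1+G$ lies in the range of $G$, and this range surjects onto the cokernel; so
  -- both are those of an endomorphism of a finite dimensional space.
  let f₀ : G.range →ₗ[K] G.range := f.restrict hmaps
  have hker : f.ker ≤ G.range := fun x hx => by
    refine range_le_of_mem G x ?_
    rw [← hf, show f x = 0 from hx]
    exact G.range.zero_mem
  have e1 : f₀.ker ≃ₗ[K] f.ker :=
    (LinearEquiv.ofEq _ _ (LinearMap.ker_restrict hmaps)).trans
      (Submodule.comapSubtypeEquivOfLe hker)
  let π : G.range →ₗ[K] V ⧸ f.range := f.range.mkQ ∘ₗ G.range.subtype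
  have hπ : Function.Surjective π := by
    intro q
    obtain ⟨v, rfl⟩ := f.range.mkQ_surjective q
    refine ⟨⟨-G v, G.range.neg_mem ⟨v, rfl⟩⟩, ?_⟩
    refine (Submodule.Quotient.eq _).2 ⟨-v, ?_⟩
    rw [hf, map_neg]
    simp only [Submodule.subtype_apply]
    abel
  have hπk : π.ker = f₀.range := by
    ext x
    constructor
    · intro hx
      have h1 : (x : V) ∈ f.range := (Submodule.Quotient.mk_eq_zero _).1 hx
      obtain ⟨u, hu⟩ := h1
      exact ⟨⟨u, range_le_of_mem G u (by rw [← hf, hu]; exact x.2)⟩, Subtype.ext hu⟩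
    · rintro ⟨u, rfl⟩
      exact (Submodule.Quotient.mk_eq_zero _).2 ⟨u, rfl⟩
  have e2 : (G.range ⧸ f₀.range) ≃ₗ[K] V ⧸ f.range :=
    (Submodule.quotEquivOfEq _ _ hπk.symm).trans (π.quotKerEquivOfSurjective hπ)
  have h0 : f₀.index = 0 := by
    rw [LinearMap.index_eq_of_finiteDimensional, sub_self]
  refine ⟨Module.Finite.equiv e1, Module.Finite.equiv e2, ?_⟩
  rw [LinearMap.index_eq_finrank_sub] at h0 ⊢
  rw [← e1.finrank_eq, ← e2.finrank_eq, h0]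

variable {E : Type*} [NormedAddCommGroup E] [InnerProductSpace ℂ E]

/-- An operator of trace class is the sum of an operator of finite rank and one of small norm. -/
theorem IsTraceClass.exists_finiteRank_add_small {F : Type*} [NormedAddCommGroup F]
    [InnerProductSpace ℂ F] {T : E →L[ℂ] F} (hT : IsTraceClass T) :
    ∃ A : E →L[ℂ] F, A.toLinearMap.HasFiniteRange ∧ ‖T - A‖ < 1 := by
  obtain ⟨x, y, h1, h2⟩ := hT
  obtain ⟨K, hK⟩ := ((tendsto_sum_nat_add fun k => ‖x k‖ * ‖y k‖).eventually
    (gt_mem_nhds (zero_lt_one' ℝ))).exists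
  refine ⟨∑ k ∈ Finset.range K, (innerSL ℂ (x k)).smulRight (y k), ?_, lt_of_le_of_lt ?_ hK⟩
  · rw [LinearMap.hasFiniteRange_iff_range]
    refine Submodule.FG.of_le (T := Submodule.span ℂ (y '' (Finset.range K : Set ℕ)))
      (Submodule.fg_span ((Finset.finite_toSet _).image _)) ?_
    rintro _ ⟨v, rfl⟩
    simp only [ContinuousLinearMap.coe_coe, sum_apply]
    exact Submodule.sum_mem _ fun k hk => Submodule.smul_mem _ _
      (Submodule.subset_span ⟨k, hk, rfl⟩)
  · refine ContinuousLinearMap.opNorm_le_bound _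
      (tsum_nonneg fun k => mul_nonneg (norm_nonneg _) (norm_nonneg _)) fun v => ?_
    have h3 := (hasSum_nat_add_iff' K).2 (h2 v)
    have h4 : (T - ∑ k ∈ Finset.range K, (innerSL ℂ (x k)).smulRight (y k)) v =
        T v - ∑ k ∈ Finset.range K, (inner ℂ (x k) v : ℂ) • y k := by
      simp
    rw [h4, ← h3.tsum_eq, ← tsum_mul_right]
    refine tsum_of_norm_bounded (((summable_nat_add_iff K).2 h1).mul_right ‖v‖).hasSum fun k => ?_
    rw [norm_smul]
    have := norm_inner_le_norm (𝕜 := ℂ) (x (k + K)) v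
    nlinarith [norm_nonneg (y (k + K))]

-- $R=U+A$ with $A$ of finite rank and $U$ invertible by the Neumann series. Then $U^{-1}$ is a
-- quasi-inverse, and $R=U(1+U^{-1}A)$ has index zero.
open scoped LinearMap.FiniteRangeSetoid in
theorem isFredholm_of_isTraceClass [CompleteSpace E] {R : E →L[ℂ] E}
    (hR : IsTraceClass (R - ContinuousLinearMap.id ℂ E)) :
    (∃ v : E →L[ℂ] E, v.toLinearMap.IsQuasiInverse R.toLinearMap) ∧
      FiniteDimensional ℂ R.toLinearMap.ker ∧ FiniteDimensional ℂ (E ⧸ R.toLinearMap.range) ∧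
      R.toLinearMap.index = 0 := by
  obtain ⟨A, hA, hsmall⟩ := hR.exists_finiteRank_add_small
  obtain ⟨U, hU⟩ : IsUnit (R - A) := by
    have h1 := isUnit_one_sub_of_norm_lt_one (x := -(R - ContinuousLinearMap.id ℂ E - A))
      (by rwa [norm_neg])
    convert h1 using 1
    rw [ContinuousLinearMap.one_def]
    abel
  set V : E →L[ℂ] E := (↑U⁻¹ : E →L[ℂ] E)
  have hVU : ∀ x, V ((U : E →L[ℂ] E) x) = x := fun x =>
    congrArg (fun T : E →L[ℂ] E => T x) U.inv_mul
  have hUV : ∀ x, (U : E →L[ℂ] E) (V x) = x := fun x =>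
    congrArg (fun T : E →L[ℂ] E => T x) U.mul_inv
  have hRU : ∀ x, R x = (U : E →L[ℂ] E) x + A x := fun x => by rw [hU]; simp
  set G : E →ₗ[ℂ] E := V.toLinearMap ∘ₗ A.toLinearMap
  have hG : G.HasFiniteRange := hA.comp_left _
  have : FiniteDimensional ℂ G.range := Module.Finite.of_fg hG.fg_range
  obtain ⟨h1, h2, h3⟩ := index_id_add_of_finiteRange G
  let Ue : E ≃ₗ[ℂ] E := LinearEquiv.ofLinearMap (U : E →L[ℂ] E).toLinearMap V.toLinearMap
    (LinearMap.ext hUV) (LinearMap.ext hVU)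
  have hcomp : R.toLinearMap = Ue.toLinearMap ∘ₗ (LinearMap.id + G) := by
    ext x
    change R x = (U : E →L[ℂ] E) (x + V (A x))
    rw [map_add, hUV, hRU]
  have hk : Ue.toLinearMap.ker = ⊥ := LinearEquiv.ker _
  have hr : Ue.toLinearMap.range = ⊤ := LinearEquiv.range _
  have i1 : FiniteDimensional ℂ Ue.toLinearMap.ker := by rw [hk]; infer_instance
  have i2 : FiniteDimensional ℂ (E ⧸ Ue.toLinearMap.range) := by rw [hr]; infer_instance
  have hsub : R.toLinearMap - Ue.toLinearMap = A.toLinearMap := by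
    refine LinearMap.ext fun x => ?_
    change R x - (U : E →L[ℂ] E) x = A x
    rw [hRU, add_sub_cancel_left]
  have hRe : R.toLinearMap ≈ Ue.toLinearMap := by
    rw [LinearMap.FiniteRangeSetoid.equiv_iff_hasFiniteRange, hsub]
    exact hA
  refine ⟨⟨V, Ue.isQuasiInverse.congr (Setoid.refl _) hRe⟩, ?_, ?_, ?_⟩
  · rw [hcomp, LinearEquiv.ker_comp]
    exact h1
  · rw [hcomp, LinearMap.range_comp]
    exact Module.Finite.equiv
      (Submodule.Quotient.equiv (LinearMap.id + G).range _ Ue rfl)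
  · rw [hcomp, LinearMap.index_comp, LinearEquiv.index_eq_zero, h3, add_zero]

end Index

/-! ### The action on the frame bundle -/

section Frame

theorem MatrixFun.map_mulOp {n : ℕ} (g : MatrixFun n) (W : Submodule ℂ (HS n)) :
    W.map g.mulOp.toLinearMap = W.comap g.inverse.mulOp.toLinearMap := by
  ext f
  rw [Submodule.mem_comap]
  constructor
  · rintro ⟨u, hu, rfl⟩
    have h1 : g.inverse.mulOp.toLinearMap (g.mulOp.toLinearMap u) = u := g.inverse_mulOp u
    rwa [h1]
  · intro hf
    exact ⟨g.inverse.mulOp f, hf, g.mulOp_inverse f⟩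

variable {n : ℕ} [NeZero n]

/-- $w$ is an isomorphism onto its closed range, so $\mathrm{pr}_+$ on the range is $\mathrm{pr}_+w$
composed with $w^{-1}$. For $gW$ the Fredholm condition thus comes from the frame $gwa^{-1}$. -/
theorem isFredholm_prPlus_range (w : HPlus n →L[ℂ] HS n) (hinj : Function.Injective w)
    (hcl : IsClosed (Set.range w))
    (hT : IsTraceClass (prPlus n ∘L w - ContinuousLinearMap.id ℂ (HPlus n))) :
    (prPlus n ∘L w.toLinearMap.range.subtypeL).IsFredholm ∧
      (prPlus n ∘L w.toLinearMap.range.subtypeL).toLinearMap.index = 0 := by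
  obtain ⟨⟨v, hv⟩, h1, h2, h3⟩ := isFredholm_of_isTraceClass hT
  let φ := w.equivRange hinj hcl
  have hφ : ∀ x, ((φ x : w.toLinearMap.range) : HS n) = w x := fun x => rfl
  have hcomp : (prPlus n ∘L w.toLinearMap.range.subtypeL).toLinearMap =
      (prPlus n ∘L w).toLinearMap ∘ₗ φ.symm.toLinearEquiv.toLinearMap := by
    refine LinearMap.ext fun x => ?_
    obtain ⟨y, rfl⟩ := φ.surjective x
    change prPlus n ((φ y : w.toLinearMap.range) : HS n) = prPlus n (w (φ.symm (φ y)))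
    rw [φ.symm_apply_apply, hφ]
  have hk : φ.symm.toLinearEquiv.toLinearMap.ker = ⊥ := LinearEquiv.ker _
  have hr : φ.symm.toLinearEquiv.toLinearMap.range = ⊤ := LinearEquiv.range _
  have i1 : FiniteDimensional ℂ φ.symm.toLinearEquiv.toLinearMap.ker := by
    rw [hk]; infer_instance
  have i2 : FiniteDimensional ℂ (HPlus n ⧸ φ.symm.toLinearEquiv.toLinearMap.range) := by
    rw [hr]; infer_instance
  constructor
  · refine ContinuousLinearMap.IsFredholm.of_isQuasiInverse (v := φ.toContinuousLinearMap ∘L v) ?_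
    rw [hcomp]
    exact (φ.symm.toLinearEquiv.isQuasiInverse).comp hv
  · rw [hcomp, LinearMap.index_comp, LinearEquiv.index_eq_zero, h3, add_zero]

theorem MatrixFun.prPlus_mulOp (g : MatrixFun n) (f : HS n) :
    prPlus n (g.mulOp f) = g.opA (prPlus n f) +
      (prPlus n ∘L g.mulOp ∘L (HMinus n).subtypeL ∘L prMinus n) f := by
  conv_lhs => rw [← prPlus_add_prMinus n f, map_add, map_add]
  rfl

theorem MatrixFun.act_apply (g : MatrixFun n) (w : HPlus n →L[ℂ] HS n) (v : HPlus n) :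
    g.act w v = g.mulOp (w (g.inverse.opA v)) := by
  rw [MatrixFun.act, g.inverse_opA]
  rfl

theorem MatrixFun.inverse_opA_opA (g : MatrixFun n) (v : HPlus n) :
    g.inverse.opA (g.opA v) = v :=
  congrArg (fun T : HPlus n →L[ℂ] HPlus n => T v) g.opA_inverse_comp

theorem MatrixFun.opA_inverse_opA (g : MatrixFun n) (v : HPlus n) :
    g.opA (g.inverse.opA v) = v :=
  congrArg (fun T : HPlus n →L[ℂ] HPlus n => T v) g.opA_comp_inverse

theorem MatrixFun.act_injective (g : MatrixFun n) {w : HPlus n →L[ℂ] HS n}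
    (hw : Function.Injective w) : Function.Injective (g.act w) := by
  intro u v h
  rw [g.act_apply, g.act_apply] at h
  have h1 := congrArg g.inverse.mulOp h
  rw [g.inverse_mulOp, g.inverse_mulOp] at h1
  have h2 := congrArg g.opA (hw h1)
  rwa [g.opA_inverse_opA, g.opA_inverse_opA] at h2

theorem MatrixFun.range_act (g : MatrixFun n) (w : HPlus n →L[ℂ] HS n) :
    (g.act w).toLinearMap.range = w.toLinearMap.range.map g.mulOp.toLinearMap := by
  ext f
  constructor
  · rintro ⟨v, rfl⟩
    exact ⟨w (g.inverse.opA v), ⟨_, rfl⟩, (g.act_apply w v).symm⟩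
  · rintro ⟨_, ⟨v, rfl⟩, rfl⟩
    refine ⟨g.opA v, ?_⟩
    refine (g.act_apply w _).trans ?_
    rw [g.inverse_opA_opA]
    rfl

/-- $\mathrm{pr}_+gwa^{-1}-1=a(\mathrm{pr}_+w-1)a^{-1}+(\mathrm{pr}_+g\,\mathrm{pr}_-)wa^{-1}$, and
the Hankel operator is of trace class. -/
theorem MatrixFun.isTraceClass_act (g : MatrixFun n) {w : HPlus n →L[ℂ] HS n}
    (hw : IsTraceClass (prPlus n ∘L w - ContinuousLinearMap.id ℂ (HPlus n))) :
    IsTraceClass (prPlus n ∘L g.act w - ContinuousLinearMap.id ℂ (HPlus n)) := by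
  have h1 := ((hw.comp_clm g.inverse.opA).clm_comp g.opA).add
    ((g.isTraceClass_hankel.comp_clm w).comp_clm g.inverse.opA)
  have h2 : prPlus n ∘L g.act w - ContinuousLinearMap.id ℂ (HPlus n) =
      g.opA ∘L (prPlus n ∘L w - ContinuousLinearMap.id ℂ (HPlus n)) ∘L g.inverse.opA +
      ((prPlus n ∘L g.mulOp ∘L (HMinus n).subtypeL ∘L prMinus n) ∘L w) ∘L g.inverse.opA := by
    refine ContinuousLinearMap.ext fun v => ?_
    rw [sub_apply, add_apply, ContinuousLinearMap.comp_apply, g.act_apply, g.prPlus_mulOp,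
      ContinuousLinearMap.comp_apply g.opA, ContinuousLinearMap.comp_apply _ g.inverse.opA,
      sub_apply, map_sub, ContinuousLinearMap.id_apply, ContinuousLinearMap.id_apply,
      g.opA_inverse_opA, ContinuousLinearMap.comp_apply (prPlus n) w,
      ContinuousLinearMap.comp_apply _ g.inverse.opA, ContinuousLinearMap.comp_apply _ w]
    abel
  rw [h2]
  exact h1

theorem MatrixFun.isClosed_map_mulOp {n : ℕ} (g : MatrixFun n) {W : Submodule ℂ (HS n)}
    (hW : IsClosed (W : Set (HS n))) : IsClosed (W.map g.mulOp.toLinearMap : Set (HS n)) := by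
  rw [g.map_mulOp]
  exact hW.preimage g.inverse.mulOp.continuous

theorem MatrixFun.prMinus_mulOp (g : MatrixFun n) (f : HS n) :
    prMinus n (g.mulOp f) = prMinus n (g.mulOp (prMinus n f : HS n)) := by
  conv_lhs => rw [← prPlus_add_prMinus n f, map_add, map_add,
    prMinus_of_mem_HPlus n (g.mulOp_mem_HPlus (prPlus n _).2), zero_add]

/-- On $gW$, $\mathrm{pr}_-$ factors as $(\mathrm{pr}_-g)\circ(\mathrm{pr}_-|_W)\circ g^{-1}$,
because $g$ preserves $H^n_+$. -/
theorem MatrixFun.isCompactOperator_prMinus_map (g : MatrixFun n) {W : Submodule ℂ (HS n)}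
    (hW : IsCompactOperator (prMinus n ∘L W.subtypeL)) :
    IsCompactOperator (prMinus n ∘L (W.map g.mulOp.toLinearMap).subtypeL) := by
  let ψ : (W.map g.mulOp.toLinearMap) →L[ℂ] W :=
    (g.inverse.mulOp ∘L (W.map g.mulOp.toLinearMap).subtypeL).codRestrict W
      fun f => (g.map_mulOp W).le f.2
  have h1 := (hW.comp_clm ψ).clm_comp (prMinus n ∘L g.mulOp ∘L (HMinus n).subtypeL)
  have h2 : ⇑(prMinus n ∘L (W.map g.mulOp.toLinearMap).subtypeL) =
      ⇑(prMinus n ∘L g.mulOp ∘L (HMinus n).subtypeL) ∘ ⇑(prMinus n ∘L W.subtypeL) ∘ ⇑ψ := by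
    funext f
    have h3 := g.prMinus_mulOp (g.inverse.mulOp (f : HS n))
    rw [g.mulOp_inverse] at h3
    exact h3
  rw [h2]
  exact h1

theorem MatrixFun.isFrame_act (g : MatrixFun n) {W : Submodule ℂ (HS n)}
    {w : HPlus n →L[ℂ] HS n} (hw : IsFrame n W w) :
    IsFrame n (W.map g.mulOp.toLinearMap) (g.act w) := by
  have hinj := g.act_injective hw.injective
  have hrange : (g.act w).toLinearMap.range = W.map g.mulOp.toLinearMap := by
    rw [g.range_act, hw.range_eq]
  have hadm := g.isTraceClass_act hw.admissible
  have hclosed := g.isClosed_map_mulOp hw.inGr.isClosed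
  have hfred := isFredholm_prPlus_range (g.act w) hinj (by
    rw [← hrange] at hclosed
    rwa [LinearMap.coe_range] at hclosed) hadm
  rw [hrange] at hfred
  exact ⟨⟨hclosed, g.isCompactOperator_prMinus_map hw.inGr.compact_minus, hfred.1, hfred.2⟩,
    hinj, hrange, hadm⟩

end Frame

/-! ### The determinants -/

section Determinants

variable {n : ℕ} [NeZero n]

/-- Only finitely many rows differ from those of $\mathrm{pr}_+w$; `F` exchanges them and has finite
rank, so the operator remains $1+$ trace class. -/
theorem exists_hasInfDet_rowMatrix (S : SSet) {w : HPlus n →L[ℂ] HS n}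
    (hw : IsTraceClass (prPlus n ∘L w - ContinuousLinearMap.id ℂ (HPlus n))) :
    ∃ d, HasInfDet (rowMatrix n S w) d := by
  obtain ⟨N, hN⟩ := S.exists_stable
  set w' := ContinuousLinearMap.adjoint w
  set F : HPlus n →L[ℂ] HPlus n := ∑ l ∈ Finset.range N,
    (innerSL ℂ (w' (e n (S.seq l)) - w' (e n l))).smulRight (ePlus n l) with hF
  have h1 : IsTraceClass (prPlus n ∘L w + F - ContinuousLinearMap.id ℂ (HPlus n)) := by
    rw [add_sub_right_comm]
    exact hw.add (isTraceClass_sum _ fun l _ => isTraceClass_rankOne _ _)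
  obtain ⟨d, hd⟩ := h1.exists_hasInfDet (ePlusBasis n)
  refine ⟨d, ?_⟩
  convert hd using 1
  ext l m
  have h2 : ∀ k : ℕ, (inner ℂ (ePlus n l) (ePlus n k) : ℂ) = if l = k then 1 else 0 := by
    intro k
    have := orthonormal_iff_ite.1 (ePlusBasis n).orthonormal l k
    rwa [ePlusBasis_apply, ePlusBasis_apply] at this
  have h3 : (inner ℂ (ePlus n l) (F (ePlus n m)) : ℂ) = if l < N then
      inner ℂ (e n (S.seq l)) (w (ePlus n m)) - inner ℂ (e n l) (w (ePlus n m)) else 0 := by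
    simp only [hF, sum_apply, inner_sum, ContinuousLinearMap.smulRight_apply, innerSL_apply_apply,
      inner_smul_right, h2, inner_sub_left, w', ContinuousLinearMap.adjoint_inner_left, mul_ite,
      mul_one, mul_zero, Finset.sum_ite_eq, Finset.mem_range]
  simp only [opMatrix, Matrix.of_apply, ePlusBasis_apply, add_apply,
    ContinuousLinearMap.comp_apply, inner_add_right, inner_ePlus_prPlus, h3]
  change (inner ℂ (e n (S.seq l)) (w (ePlus n m)) : ℂ) = _
  split_ifs with hl
  · ring
  · rw [hN l (by omega), add_zero]

/-- The operator whose matrix is `M_S`. -/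
theorem MatrixFun.exists_columnOp (g : MatrixFun n) (S : SSet) :
    ∃ A : HPlus n →L[ℂ] HPlus n, IsTraceClass (A - g.opA) ∧
      ∀ m : ℕ, A (ePlus n m) = prPlus n (g.mulOp (e n (S.seq m))) := by
  obtain ⟨N, hN⟩ := S.exists_stable
  -- From column $N$ on, $M_S$ agrees with $M_0$, the matrix of $a$; a finite rank term replaces the
  -- earlier columns.
  refine ⟨g.opA + ∑ m ∈ Finset.range N, (innerSL ℂ (ePlus n m)).smulRight
    (prPlus n (g.mulOp (e n (S.seq m))) - g.opA (ePlus n m)), ?_, fun m => ?_⟩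
  · rw [add_sub_cancel_left]
    exact isTraceClass_sum _ fun l _ => isTraceClass_rankOne _ _
  · have h2 : ∀ k : ℕ, (inner ℂ (ePlus n k) (ePlus n m) : ℂ) = if k = m then 1 else 0 := by
      intro k
      have := orthonormal_iff_ite.1 (ePlusBasis n).orthonormal k m
      rwa [ePlusBasis_apply, ePlusBasis_apply] at this
    simp only [add_apply, sum_apply, ContinuousLinearMap.smulRight_apply, innerSL_apply_apply, h2,
      ite_smul, one_smul, zero_smul, Finset.sum_ite_eq', Finset.mem_range]
    split_ifs with hm
    · abel
    · rw [hN m (by omega), add_zero]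
      rfl

theorem MatrixFun.schurMatrix_eq (g : MatrixFun n) (S : SSet) {A : HPlus n →L[ℂ] HPlus n}
    (hA : ∀ m : ℕ, A (ePlus n m) = prPlus n (g.mulOp (e n (S.seq m)))) :
    schurMatrix n g.coeff S = opMatrix (ePlusBasis n) (A ∘L g.inverse.opA) := by
  obtain ⟨N, hN⟩ := S.exists_stable
  ext l m
  have h3 := hasSum_inner_comp A g.inverse.opA l (ePlus n m)
  simp only [hA, inner_ePlus_prPlus, MatrixFun.inner_e_mulOp_e,
    MatrixFun.inner_ePlus_inverse_opA] at h3
  simp only [opMatrix, Matrix.of_apply, ePlusBasis_apply, ContinuousLinearMap.comp_apply,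
    schurMatrix, infMul, MS]
  rw [← h3.tsum_eq, tsum_eq_finsum]
  · rfl
  refine (Finset.range (max N (n * (l / n + 1)))).finite_toSet.subset fun p hp => ?_
  by_contra hp'
  simp only [Finset.coe_range, Set.mem_Iio, not_lt, max_le_iff] at hp'
  have h6 : l / n + 1 ≤ p / n := by
    rw [Nat.le_div_iff_mul_le (Nat.pos_of_ne_zero (NeZero.ne n)), mul_comm]
    exact hp'.2
  apply hp
  simp only [blockToeplitz]
  rw [hN p hp'.1]
  simp only [← Int.natCast_div, Nat.cast_le]
  rw [if_neg (show ¬ p / n ≤ l / n by omega), zero_mul]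

/-- The `n`-Schur function is a minor of `a⁻¹ pr_+ g`. -/
theorem MatrixFun.exists_hasInfDet_schurMatrix (g : MatrixFun n) (S : SSet) :
    ∃ d, HasInfDet (schurMatrix n g.coeff S) d ∧ HasInfDet (Matrix.of fun l m : ℕ =>
      (inner ℂ (ePlus n l) (g.inverse.opA (prPlus n (g.mulOp (e n (S.seq m))))) : ℂ)) d := by
  obtain ⟨A, hA, hAm⟩ := g.exists_columnOp S
  have h1 : IsTraceClass (A ∘L g.inverse.opA - ContinuousLinearMap.id ℂ (HPlus n)) := by
    have := hA.comp_clm g.inverse.opA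
    rwa [ContinuousLinearMap.sub_comp, g.opA_comp_inverse] at this
  -- $a^{-1}(Aa^{-1})a=a^{-1}A$, whose columns are $a^{-1}\mathrm{pr}_+g\,e_{s_m}$.
  obtain ⟨d, h2, h3⟩ := exists_hasInfDet_conj (ePlusBasis n) h1 g.inverse.opA g.opA
    g.opA_inverse_comp g.opA_comp_inverse
  refine ⟨d, by rwa [g.schurMatrix_eq S hAm], ?_⟩
  convert h3 using 1
  ext l m
  simp only [opMatrix, Matrix.of_apply, ePlusBasis_apply, ContinuousLinearMap.comp_apply,
    g.inverse_opA_opA, hAm]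

/-- Conjugation by $a$ moves the factor $a^{-1}$ from the right of $\mathrm{pr}_+gw$ to the left,
which exhibits the product to be expanded. -/
theorem MatrixFun.exists_hasInfDet_act (g : MatrixFun n) {w : HPlus n →L[ℂ] HS n}
    (hw : IsTraceClass (prPlus n ∘L g.act w - ContinuousLinearMap.id ℂ (HPlus n))) :
    ∃ d, HasInfDet (rowMatrix n SSet.base (g.act w)) d ∧ HasInfDet (Matrix.of fun l m : ℕ =>
      (inner ℂ (ePlus n l) (g.inverse.opA (prPlus n (g.mulOp (w (ePlus n m))))) : ℂ)) d := by
  obtain ⟨d, h2, h3⟩ := exists_hasInfDet_conj (ePlusBasis n) hw g.inverse.opA g.opA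
    g.opA_inverse_comp g.opA_comp_inverse
  refine ⟨d, ?_, ?_⟩
  · convert h2 using 1
    ext l m
    simp only [opMatrix, Matrix.of_apply, ePlusBasis_apply, ContinuousLinearMap.comp_apply,
      inner_ePlus_prPlus]
    rfl
  · convert h3 using 1
    ext l m
    simp only [opMatrix, Matrix.of_apply, ePlusBasis_apply, ContinuousLinearMap.comp_apply,
      g.act_apply, g.inverse_opA_opA]

theorem MatrixFun.hasSum_plucker_mul_nSchur (g : MatrixFun n) {W : Submodule ℂ (HS n)}
    {w : HPlus n →L[ℂ] HS n} (hw : IsFrame n W w) :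
    HasSum (fun S : SSet => plucker n S w * nSchur n g.coeff S)
      (plucker n SSet.base (g.act w)) := by
  have hframe := g.isFrame_act hw
  have hrow := fun S : SSet => exists_hasInfDet_rowMatrix S hw.admissible
  obtain ⟨L, hL1, hL2⟩ := g.exists_hasInfDet_act hframe.admissible
  have hschur := fun S : SSet => g.exists_hasInfDet_schurMatrix S
  obtain ⟨θ, C, hθ0, hθ1, hC0, hg, hg'⟩ := exists_common_decay g g.inverse
  obtain ⟨x, y, α, hα, hx, hy, hs⟩ := hw.admissible.exists_balanced
  have hon : ∀ l m : ℕ, (inner ℂ (ePlus n l) (ePlus n m) : ℂ) = if l = m then 1 else 0 := by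
    intro l m
    have := orthonormal_iff_ite.1 (ePlusBasis n).orthonormal l m
    rwa [ePlusBasis_apply, ePlusBasis_apply] at this
  have hbessel : ∀ (I : Finset ℕ) (v : HPlus n),
      ∑ l ∈ I, ‖(inner ℂ (ePlus n l) v : ℂ)‖ ^ 2 ≤ ‖v‖ ^ 2 := by
    intro I v
    have := (ePlusBasis n).orthonormal.sum_inner_products_le v (s := I)
    simpa only [ePlusBasis_apply] using this
  have hbessel' : ∀ (N : ℕ) (v : HPlus n),
      ∑ m : Fin N, ‖(inner ℂ v (ePlus n m) : ℂ)‖ ^ 2 ≤ ‖v‖ ^ 2 := by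
    intro N v
    rw [← Finset.sum_range fun m => ‖(inner ℂ v (ePlus n m) : ℂ)‖ ^ 2]
    simp only [norm_inner_symm v]
    exact hbessel _ v
  have hτ0 : 0 < √θ := Real.sqrt_pos.2 hθ0
  have hτ1 : √θ < 1 := by rw [Real.sqrt_lt' one_pos, one_pow]; exact hθ1
  have hres := hasSum_infinite_cauchyBinet
    (A := fun l s => (inner ℂ (ePlus n l) (g.inverse.opA (prPlus n (g.mulOp (e n s)))) : ℂ))
    (w := fun s m => (inner ℂ (e n s) (w (ePlus n m)) : ℂ))
    (v := fun l m =>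
      (inner ℂ (ePlus n l) (g.inverse.opA (prPlus n (g.mulOp (w (ePlus n m))))) : ℂ))
    -- The square of this weight is $(k+1)^2\theta^k$ with $k=\lfloor l/n\rfloor$, which dominates
    -- the factor $(k+1)\theta^k$ of the decay bound.
    (ω := fun l => (((l / n : ℕ) : ℝ) + 1) * √θ ^ (l / n))
    (β := fun i => n * C ^ 2 * θ ^ (i / n + 1))
    (Y := fun l k => (inner ℂ (ePlus n l) (y k) : ℂ))
    (X := fun k m => (inner ℂ (x k) (ePlus n m) : ℂ)) (α := α) (C := max 1 ‖w‖)
    (p := fun S => plucker n S w) (f := fun S => nSchur n g.coeff S)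
    (L := plucker n SSet.base (g.act w))
    (fun l => by positivity) (fun i => by positivity) ?_ ?_ ?_ ?_ (le_max_left _ _) ?_ hα
    (fun k I => (hbessel I (y k)).trans (hy k)) (fun k N => (hbessel' N (x k)).trans (hx k))
    ?_ ?_ ?_ ?_ ?_
  · exact hres
  · refine summable_comp_div (f := fun k : ℕ => ((k : ℝ) + 1) * √θ ^ k)
      (fun k => by positivity) ?_
    have h1 := summable_pow_mul_geometric_of_norm_lt_one 1
      (show ‖√θ‖ < 1 by rwa [Real.norm_of_nonneg hτ0.le])
    refine (h1.add (summable_geometric_of_lt_one hτ0.le hτ1)).congr fun k => ?_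
    ring
  · refine Summable.mul_left _ (summable_comp_div (f := fun k : ℕ => θ ^ (k + 1))
      (fun k => by positivity) ?_)
    exact (summable_nat_add_iff 1).2 (summable_geometric_of_lt_one hθ0.le hθ1)
  · intro l s
    have h1 : prPlus n (g.mulOp (e n s)) = g.opA (ePlus n s) := rfl
    simp only [h1, g.inverse_opA_opA, hon]
  · intro l i
    refine (g.norm_inner_inverse_opA_prPlus_le hθ0 hC0 hg hg' l i).trans ?_
    refine mul_le_mul_of_nonneg_right ?_ (by positivity)
    rw [mul_pow, ← pow_mul, mul_comm (l / n) 2, pow_mul, Real.sq_sqrt hθ0.le]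
    refine mul_le_mul_of_nonneg_right ?_ (by positivity)
    nlinarith [Nat.cast_nonneg (α := ℝ) (l / n)]
  · intro s N
    have h1 : ∀ m : ℕ, (inner ℂ (e n s) (w (ePlus n m)) : ℂ) =
        inner ℂ (ContinuousLinearMap.adjoint w (e n s)) (ePlus n m) := fun m =>
      (ContinuousLinearMap.adjoint_inner_left w _ _).symm
    simp only [h1]
    refine (hbessel' N _).trans (pow_le_pow_left₀ (norm_nonneg _) ?_ 2)
    refine (ContinuousLinearMap.le_opNorm _ _).trans ?_
    rw [norm_e, mul_one, LinearIsometryEquiv.norm_map]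
    exact le_max_right _ _
  · intro l m
    have h1 := (hs (ePlus n m)).mapL (innerSL ℂ (ePlus n l))
    simp only [sub_apply, ContinuousLinearMap.comp_apply, ContinuousLinearMap.id_apply,
      innerSL_apply_apply, inner_sub_right, inner_smul_right, inner_ePlus_prPlus, hon] at h1
    exact h1.congr_fun fun k => mul_comm _ _
  · intro l m
    have h1 := (hasSum_prMinus n (w (ePlus n m))).mapL
      (innerSL ℂ (ePlus n l) ∘L g.inverse.opA ∘L prPlus n ∘L g.mulOp)
    simp only [map_smul, ContinuousLinearMap.comp_apply, innerSL_apply_apply, smul_eq_mul] at h1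
    -- $a^{-1}\mathrm{pr}_+gw-\mathrm{pr}_+w=a^{-1}\mathrm{pr}_+g\,\mathrm{pr}_-w$: the identity
    -- block of $A$ contributes $\mathrm{pr}_+w$, the negative columns the rest.
    have h2 : (inner ℂ (ePlus n l) (g.inverse.opA (prPlus n (g.mulOp (w (ePlus n m))))) : ℂ) -
        inner ℂ (e n l) (w (ePlus n m)) = inner ℂ (ePlus n l)
          (g.inverse.opA (prPlus n (g.mulOp (prMinus n (w (ePlus n m)) : HS n)))) := by
      rw [g.prPlus_mulOp (w (ePlus n m)), map_add, g.inverse_opA_opA, inner_add_right,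
        inner_ePlus_prPlus, add_sub_cancel_left]
      rfl
    rw [h2]
    exact h1.congr_fun fun k => mul_comm _ _
  · intro S
    obtain ⟨d, hd⟩ := hrow S
    have : plucker n S w = d := hd.infDet_eq
    rw [this]
    exact hd
  · intro S
    obtain ⟨d, h1, h2⟩ := hschur S
    have : nSchur n g.coeff S = d := h1.infDet_eq
    rw [this]
    exact h2
  · have : plucker n SSet.base (g.act w) = L := hL1.infDet_eq
    rw [this]
    exact hL2

end Determinants

end NSchur

theorem theorem1 (n : ℕ) [NeZero n] (g : NSchur.MatrixFun n)
    (W : Submodule ℂ (NSchur.HS n))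
    (w : NSchur.HPlus n →L[ℂ] NSchur.HS n) (hw : NSchur.IsFrame n W w) :
    -- the action of `g` on the frame bundle is defined
    IsUnit g.opA ∧
    NSchur.IsFrame n (W.map g.mulOp.toLinearMap) (g.act w) ∧
    -- all the infinite determinants exist
    (∀ S : NSchur.SSet, ∃ d : ℂ, NSchur.HasInfDet (NSchur.rowMatrix n S w) d) ∧
    (∃ d : ℂ, NSchur.HasInfDet (NSchur.rowMatrix n NSchur.SSet.base (g.act w)) d) ∧
    (∀ S : NSchur.SSet, ∃ d : ℂ, NSchur.HasInfDet (NSchur.schurMatrix n g.coeff S) d) ∧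
    -- the expansion
    HasSum (fun S : NSchur.SSet => NSchur.plucker n S w * NSchur.nSchur n g.coeff S)
      (NSchur.plucker n NSchur.SSet.base (g.act w)) :=
  ⟨g.isUnit_opA, g.isFrame_act hw, fun S => NSchur.exists_hasInfDet_rowMatrix S hw.admissible,
    (g.exists_hasInfDet_act (g.isFrame_act hw).admissible).imp fun _ h => h.1,
    fun S => (g.exists_hasInfDet_schurMatrix S).imp fun _ h => h.1,
    g.hasSum_plucker_mul_nSchur hw⟩
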